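/- An ultragraph $\mathcal G=(G^0,\mathcal G^1,r,s)$ consists of a set $G^0$ of vertices, a set $\mathcal G^1$ of edges, a source map $s:\mathcal G^1\to G^0$ and a range map $r:\mathcal G^1\to \mathcal P(G^0)\setminus\{\emptyset\}$. Let $\mathcal G^0$ be the smallest family of subsets of $G^0$ that contains $\emptyset$, all $\{v\}$ ($v\in G^0$) and all $r(e)$ ($e\in\mathcal G^1$) and is closed under finite unions and finite intersections. The ultragraph C*-algebra $C^*(\mathcal G)$ is the universal C*-algebra generated by projections $\{p_A: A\in\mathcal G^0\}$ and partial isometries $\{s_e:e\in\mathcal G^1\}$ with mutually orthogonal ranges such that (1) $p_\emptyset=0$, $p_Ap_B=p_{A\cap B}$ and $p_{A\cup B}=p_A+p_B-p_{A\cap B}$ for $A,B\in\mathcal G^0$; (2) $s_e^*s_e=p_{r(e)}$ for $e\in\mathcal G^1$; (3) $s_es_e^*\le p_{\{s(e)\}}$ for $e\in\mathcal G^1$; (4) $p_{\{v\}}=\sum_{s(e)=v}s_es_e^*$ for every $v\in G^0$ with $0<|s^{-1}(v)|<\infty$. Let $\mathsf X$ be a subshift over an alphabet $\mathscr A$, that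 is, the set of all $x\in\mathscr A^{\mathbb N}$ in which no word of some fixed set $F\subseteq\mathscr A^*$ occurs. Let $\mathcal L_{\mathsf X}$ be the set of finite words that occur as initial words of elements of $\mathsf X$, let $\omega$ be the empty word, and put $C(\alpha,\beta)=\{\beta x\in\mathsf X:\alpha x\in\mathsf X\}$ for $\alpha,\beta\in\mathcal L_{\mathsf X}$. Let $\mathcal B$ be the smallest family of subsets of $\mathsf X$ that contains $\emptyset$ and all $C(\alpha,\beta)$ with $\alpha,\beta\in\mathcal L_{\mathsf X}$ not both equal to $\omega$, and is closed under finite unions, finite intersections and relative complements. The (not necessarily unital) subshift C*-algebra $\mathcal O_{\mathsf X}$ is the universal C*-algebra generated by projections $\{p_A:A\in\mathcal B\}$ and partial isometries $\{s_a:a\in\mathscr A\}$ such that (i) $p_{A\cap B}=p_Ap_B$, $p_{A\cup B}=p_A+p_B-p_{A\cap B}$ and $p_\emptyset=0$ for $A,B\in\mathcal B$; (ii) $s_\beta s_\alpha^*s_\alpha s_\beta^*=p_{C(\alpha,\beta)}$, $s_\alpha^*s_\alpha=p_{C(\alpha,\omega)}$ and $s_\beta s_\beta^*=p_{C(\omega,\beta)}$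 for all $\alpha,\beta\in\mathcal L_{\mathsf X}\setminus\{\omega\}$, where $s_\alpha=s_{\alpha_1}\cdots s_{\alpha_n}$ for $\alpha=\alpha_1\cdots\alpha_n$. **Proposition.** Let $\mathcal G$ be an ultragraph such that every vertex is regular, that is, $0<|s^{-1}(v)|<\infty$ for all $v\in G^0$. Let $\mathsf X_{\mathcal G}$ be its one-sided edge subshift: the subshift over the alphabet $\mathcal G^1$ given by the set of forbidden words $\{ef: e,f\in\mathcal G^1,\ s(f)\notin r(e)\}$. Then $C^*(\mathcal G)$ and $\mathcal O_{\mathsf X_{\mathcal G}}$ are isomorphic as C*-algebras. -/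

import Mathlib

open scoped ENNReal

universe u v w

/-! ### Universal C⋆-algebras generated by partial isometries subject to relations -/

/-- `s` is a partial isometry: `s s* s = s`. -/
def IsPartialIsometry {B : Type*} [Mul B] [Star B] (s : B) : Prop :=
  s * star s * s = s

/-- A representation of the generators `X` and relations `R`: a C⋆-algebra together with a
family of partial isometries indexed by `X` which satisfies `R`. -/
structure CStarRep (X : Type u)
    (R : ∀ (B : Type u) [NonUnitalCStarAlgebra B], (X → B) → Prop) : Type (u + 1) where
  /-- the C⋆-algebra -/
  carrier : Type u
  [inst : NonUnitalCStarAlgebra carrier]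
  /-- the images of the generators -/
  gen : X → carrier
  partialIsometry : ∀ x, IsPartialIsometry (gen x)
  relations : R carrier gen

attribute [instance] CStarRep.inst

/-- A partial isometry in a C⋆-algebra has norm at most one. -/
theorem IsPartialIsometry.norm_le_one {B : Type*} [NonUnitalCStarAlgebra B] {s : B}
    (hs : IsPartialIsometry s) : ‖s‖ ≤ 1 := by
  have h1 : (star s * s) * (star s * s) = star s * s := by
    have h : s * star s * s = s := hs
    calc (star s * s) * (star s * s) = star s * (s * star s * s) := by simp only [mul_assoc]
      _ = star s * s := by rw [h]
  have h2 : ‖star s * s‖ * ‖star s * s‖ = ‖star s * s‖ := by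
    have h3 := CStarRing.norm_star_mul_self (x := star s * s)
    rw [star_mul, star_star, h1] at h3
    exact h3.symm
  rw [CStarRing.norm_star_mul_self] at h2
  by_contra hlt
  push Not at hlt
  have h4 : 1 < ‖s‖ * ‖s‖ := by nlinarith
  nlinarith

/-- Projections are partial isometries. -/
theorem IsStarProjection.isPartialIsometry {B : Type*} [Mul B] [Star B] {p : B}
    (hp : IsStarProjection p) : IsPartialIsometry p := by
  have h1 : star p = p := hp.isSelfAdjoint
  have h2 : p * p = p := hp.isIdempotentElem
  rw [IsPartialIsometry, h1, h2, h2]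

namespace UniversalCStar

variable (X : Type u) (R : ∀ (B : Type u) [NonUnitalCStarAlgebra B], (X → B) → Prop)

/-- The generator `x` in the C⋆-algebra of bounded families `∏ B` over all representations. -/
noncomputable def genLp (x : X) : lp (fun i : CStarRep X R => i.carrier) ∞ :=
  ⟨fun i => i.gen x, memℓp_infty ⟨1, by
    rintro _ ⟨i, rfl⟩; exact (i.partialIsometry x).norm_le_one⟩⟩

/-- The C⋆-subalgebra generated by the generators. -/
noncomputable def subalgebra :
    NonUnitalStarSubalgebra ℂ (lp (fun i : CStarRep X R => i.carrier) ∞) :=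
  (NonUnitalStarAlgebra.adjoin ℂ (Set.range (genLp X R))).topologicalClosure

end UniversalCStar

/-- The universal C⋆-algebra generated by partial isometries `x ∈ X` subject to the relations `R`:
the C⋆-algebra generated by the generators inside the C⋆-algebra of all bounded families indexed by
the representations of `X` and `R`. -/
def UniversalCStar (X : Type u)
    (R : ∀ (B : Type u) [NonUnitalCStarAlgebra B], (X → B) → Prop) : Type (u + 1) :=
  UniversalCStar.subalgebra X R

namespace UniversalCStar

variable (X : Type u) (R : ∀ (B : Type u) [NonUnitalCStarAlgebra B], (X → B) → Prop)

noncomputable instance : NonUnitalCStarAlgebra (UniversalCStar X R) :=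
  NonUnitalStarSubalgebra.nonUnitalCStarAlgebra (UniversalCStar.subalgebra X R)
    (h_closed := NonUnitalStarSubalgebra.isClosed_topologicalClosure _)

/-- The generators of the universal C⋆-algebra. -/
noncomputable def gen (x : X) : UniversalCStar X R :=
  ⟨genLp X R x, NonUnitalStarSubalgebra.le_topologicalClosure _
    (NonUnitalStarAlgebra.subset_adjoin ℂ _ ⟨x, rfl⟩)⟩

variable {X R}

/-- The homomorphism from the universal C⋆-algebra given by a representation. -/
noncomputable def ev (i : CStarRep X R) : UniversalCStar X R →⋆ₙₐ[ℂ] i.carrier where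
  toFun a := a.1 i
  map_smul' _ _ := rfl
  map_zero' := rfl
  map_add' _ _ := rfl
  map_mul' _ _ := rfl
  map_star' _ := rfl

theorem ev_gen (i : CStarRep X R) (x : X) : ev i (gen X R x) = i.gen x := rfl

theorem ext_ev {a b : UniversalCStar X R} (h : ∀ i : CStarRep X R, ev i a = ev i b) : a = b :=
  Subtype.ext (lp.ext (funext h))

/-- Homomorphisms out of the universal C⋆-algebra are determined by the generators. -/
theorem hom_ext {B : Type w} [NonUnitalCStarAlgebra B] {f g : UniversalCStar X R →⋆ₙₐ[ℂ] B}
    (h : ∀ x, f (gen X R x) = g (gen X R x)) : f = g := by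
  have hf : Continuous f := AddMonoidHomClass.continuous_of_bound f 1 (by
    simpa only [one_mul] using! NonUnitalStarAlgHom.norm_apply_le f)
  have hg : Continuous g := AddMonoidHomClass.continuous_of_bound g 1 (by
    simpa only [one_mul] using! NonUnitalStarAlgHom.norm_apply_le g)
  let S : NonUnitalStarSubalgebra ℂ (UniversalCStar X R) := NonUnitalStarAlgHom.equalizer f g
  let ι : UniversalCStar X R →⋆ₙₐ[ℂ] lp (fun i : CStarRep X R => i.carrier) ∞ :=
    NonUnitalStarSubalgebraClass.subtype (subalgebra X R)
  have hι : Topology.IsClosedEmbedding ι :=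
    (NonUnitalStarSubalgebra.isClosed_topologicalClosure
      (NonUnitalStarAlgebra.adjoin ℂ (Set.range (genLp X R)))).isClosedEmbedding_subtypeVal
  have hS : IsClosed (S : Set (UniversalCStar X R)) := isClosed_eq hf hg
  have hle : subalgebra X R ≤ NonUnitalStarSubalgebra.map ι S := by
    refine NonUnitalStarSubalgebra.topologicalClosure_minimal _ ?_ (hι.isClosedMap _ hS)
    refine NonUnitalStarAlgebra.adjoin_le ?_
    rintro _ ⟨x, rfl⟩
    exact ⟨gen X R x, h x, rfl⟩
  ext a
  obtain ⟨a', ha', he⟩ := hle a.2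
  have : a' = a := Subtype.ext he
  exact this ▸ ha'

/-- Formal star-polynomials in the variables `X`. -/
inductive Term (X : Type u) : Type u
  | var (x : X) : Term X
  | zero : Term X
  | add (s t : Term X) : Term X
  | mul (s t : Term X) : Term X
  | smul (c : ℂ) (t : Term X) : Term X
  | star (t : Term X) : Term X

/-- The value of a formal star-polynomial. -/
def Term.eval {B : Type w} [NonUnitalCStarAlgebra B] (b : X → B) : Term X → B
  | .var x => b x
  | .zero => 0
  | .add s t => s.eval b + t.eval b
  | .mul s t => s.eval b * t.eval b
  | .smul c t => c • t.eval b
  | .star t => Star.star (t.eval b)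

/-- The closed star-subalgebra generated by a family indexed by `X : Type u` is `u`-small. -/
theorem small_closure_adjoin {B : Type w} [NonUnitalCStarAlgebra B] (b : X → B) :
    Small.{u} ((NonUnitalStarAlgebra.adjoin ℂ (Set.range b)).topologicalClosure) := by
  have h1 : ∀ a ∈ NonUnitalStarAlgebra.adjoin ℂ (Set.range b), ∃ t : Term X, t.eval b = a := by
    intro a ha
    induction ha using NonUnitalStarAlgebra.adjoin_induction with
    | mem a ha => obtain ⟨x, rfl⟩ := ha; exact ⟨.var x, rfl⟩
    | add a c _ _ iha ihc =>
      obtain ⟨s, rfl⟩ := iha; obtain ⟨t, rfl⟩ := ihc; exact ⟨.add s t, rfl⟩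
    | zero => exact ⟨.zero, rfl⟩
    | mul a c _ _ iha ihc =>
      obtain ⟨s, rfl⟩ := iha; obtain ⟨t, rfl⟩ := ihc; exact ⟨.mul s t, rfl⟩
    | smul r a _ iha => obtain ⟨s, rfl⟩ := iha; exact ⟨.smul r s, rfl⟩
    | star a _ iha => obtain ⟨s, rfl⟩ := iha; exact ⟨.star s, rfl⟩
  have h2 : ∀ a : (NonUnitalStarAlgebra.adjoin ℂ (Set.range b)).topologicalClosure,
      ∃ t : ℕ → Term X, Filter.Tendsto (fun n => (t n).eval b) Filter.atTop (nhds (a : B)) := by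
    intro a
    obtain ⟨y, hy, hlim⟩ := mem_closure_iff_seq_limit.1 a.2
    choose t ht using fun n => h1 (y n) (hy n)
    exact ⟨t, by simpa only [ht] using hlim⟩
  choose t ht using h2
  refine small_of_injective (f := t) fun a c hac => Subtype.ext ?_
  exact tendsto_nhds_unique (ht a) (hac ▸ ht c)

/-- A C⋆-algebra structure on a small copy of a C⋆-algebra. -/
theorem exists_shrink (D : Type w) [NonUnitalCStarAlgebra D] [Small.{u} D] :
    ∃ (C : Type u) (_ : NonUnitalCStarAlgebra C) (j : C →⋆ₙₐ[ℂ] D), Function.Bijective j := by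
  let e : Shrink.{u} D ≃ₗ[ℂ] D := Shrink.linearEquiv ℂ D
  have he : ∀ x y, e (x * y) = e x * e y := fun x y => (Shrink.ringEquiv D).map_mul x y
  let f : Shrink.{u} D →ₙ+* D :=
    { toFun := e, map_mul' := he, map_zero' := e.map_zero, map_add' := e.map_add }
  have hf : Function.Injective f := e.injective
  let i1 : NonUnitalNormedRing (Shrink.{u} D) := NonUnitalNormedRing.induced _ D f hf
  let i2 : NormedSpace ℂ (Shrink.{u} D) := NormedSpace.induced ℂ (Shrink.{u} D) D e
  let i3 : StarRing (Shrink.{u} D) :=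
    { star := fun x => e.symm (star (e x))
      star_involutive := fun x => by simp
      star_mul := fun x y => e.injective (by simp [he])
      star_add := fun x y => e.injective (by simp) }
  have hs : ∀ x, e (star x) = star (e x) := fun x => e.apply_symm_apply _
  have hn : ∀ x, ‖e x‖ = ‖x‖ := fun x => rfl
  have hiso : Isometry e := AddMonoidHomClass.isometry_of_norm e hn
  have i4 : CompleteSpace (Shrink.{u} D) :=
    by
    rw [hiso.isUniformInducing.completeSpace_congr e.surjective]; infer_instance
  let i5 : NonUnitalCStarAlgebra (Shrink.{u} D) :=
    { i1, i2, i3, i4 with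
      norm_mul_self_le := fun x => by
        rw [← hn, ← hn, he, hs, CStarRing.norm_star_mul_self]
      smul_assoc := fun c x y => e.injective (by
        simp only [smul_eq_mul, he, map_smul, smul_mul_assoc])
      smul_comm := fun c x y => e.injective (by
        simp only [smul_eq_mul, he, map_smul, mul_smul_comm])
      star_smul := fun c x => e.injective (by simp only [hs, map_smul, star_smul]) }
  exact ⟨Shrink.{u} D, i5,
    { toFun := e, map_smul' := e.map_smul, map_zero' := e.map_zero, map_add' := e.map_add,
      map_mul' := he, map_star' := hs }, e.bijective⟩

/-- Every family of partial isometries which satisfies the relations (transported to small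
C⋆-algebras), in a C⋆-algebra in any universe, is the image of the generators. -/
theorem exists_lift {B : Type w} [NonUnitalCStarAlgebra B] (b : X → B)
    (hb : ∀ x, IsPartialIsometry (b x))
    (hR : ∀ (C : Type u) [NonUnitalCStarAlgebra C] (j : C →⋆ₙₐ[ℂ] B) (c : X → C),
      Function.Injective j → (∀ x, j (c x) = b x) → R C c) :
    ∃ φ : UniversalCStar X R →⋆ₙₐ[ℂ] B, ∀ x, φ (gen X R x) = b x := by
  let S := (NonUnitalStarAlgebra.adjoin ℂ (Set.range b)).topologicalClosure
  let iS : NonUnitalCStarAlgebra S := NonUnitalStarSubalgebra.nonUnitalCStarAlgebra S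
    (h_closed := NonUnitalStarSubalgebra.isClosed_topologicalClosure _)
  have hsm : Small.{u} S := small_closure_adjoin b
  obtain ⟨C, iC, j, hj⟩ := exists_shrink.{u} S
  let k : C →⋆ₙₐ[ℂ] B := (NonUnitalStarSubalgebraClass.subtype S).comp j
  have hk : Function.Injective k := Subtype.val_injective.comp hj.1
  have hc : ∀ x, ∃ c, k c = b x := fun x => by
    obtain ⟨c, hc⟩ := hj.2 ⟨b x, NonUnitalStarSubalgebra.le_topologicalClosure _
      (NonUnitalStarAlgebra.subset_adjoin ℂ _ ⟨x, rfl⟩)⟩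
    exact ⟨c, congrArg Subtype.val hc⟩
  choose c hc using hc
  let i : CStarRep X R :=
    { carrier := C
      gen := c
      partialIsometry := fun x => hk (by
        rw [map_mul, map_mul, map_star, hc]; exact hb x)
      relations := hR C k c hk hc }
  exact ⟨k.comp (ev i), hc⟩

end UniversalCStar

/-! ### Ultragraphs -/

/-- An ultragraph with vertex set `V` and edge set `E`: every edge has a source vertex and a
nonempty set of vertices as its range. -/
structure Ultragraph (V : Type u) (E : Type v) where
  /-- the source of an edge -/
  source : E → V
  /-- the range of an edge -/
  range : E → Set V
  range_nonempty : ∀ e, (range e).Nonempty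

namespace Ultragraph

variable {V : Type u} {E : Type v} (G : Ultragraph V E)

/-- A vertex is regular if it emits at least one and only finitely many edges. -/
def IsRegular (v : V) : Prop :=
  {e | G.source e = v}.Nonempty ∧ {e | G.source e = v}.Finite

/-- Membership in the smallest family of sets of vertices which contains the empty set, the
singletons and the ranges of edges, and is closed under finite unions and intersections. -/
inductive IsGenVertex : Set V → Prop
  | empty : IsGenVertex ∅
  | vertex (v : V) : IsGenVertex {v}
  | range (e : E) : IsGenVertex (G.range e)
  | union {A B : Set V} : IsGenVertex A → IsGenVertex B → IsGenVertex (A ∪ B)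
  | inter {A B : Set V} : IsGenVertex A → IsGenVertex B → IsGenVertex (A ∩ B)

/-- The generalized vertices of an ultragraph. -/
def GenVertex : Type u := {A : Set V // G.IsGenVertex A}

/-- Cuntz–Krieger families of an ultragraph. For projections `p`, `q` the relation `q ≤ p` means
`p q = q`. -/
structure IsCKFamily {B : Type w} [NonUnitalCStarAlgebra B] (p : G.GenVertex → B) (s : E → B) :
    Prop where
  projection : ∀ A, IsStarProjection (p A)
  partialIsometry : ∀ e, IsPartialIsometry (s e)
  orthogonal : ∀ e f, e ≠ f → (s e * star (s e)) * (s f * star (s f)) = 0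
  p_empty : p ⟨∅, .empty⟩ = 0
  p_inter : ∀ A B : G.GenVertex, p A * p B = p ⟨A.1 ∩ B.1, .inter A.2 B.2⟩
  p_union : ∀ A B : G.GenVertex,
    p ⟨A.1 ∪ B.1, .union A.2 B.2⟩ = p A + p B - p ⟨A.1 ∩ B.1, .inter A.2 B.2⟩
  initial : ∀ e, star (s e) * s e = p ⟨G.range e, .range e⟩
  final_le : ∀ e, p ⟨{G.source e}, .vertex _⟩ * (s e * star (s e)) = s e * star (s e)
  vertex_eq_sum : ∀ (v : V) (h : G.IsRegular v),
    p ⟨{v}, .vertex v⟩ = ∑ e ∈ h.2.toFinset, s e * star (s e)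

/-- The ultragraph C⋆-algebra: the universal C⋆-algebra generated by a Cuntz–Krieger family. -/
abbrev CStar : Type (max u v + 1) :=
  UniversalCStar (G.GenVertex ⊕ E)
    (fun _ _ b => G.IsCKFamily (fun A => b (Sum.inl A)) (fun e => b (Sum.inr e)))

variable {G}

/-- Cuntz–Krieger families are detected by jointly injective families of homomorphisms. -/
theorem IsCKFamily.of_injective {B : Type w} [NonUnitalCStarAlgebra B] {p : G.GenVertex → B}
    {s : E → B} {I : Type*} {C : I → Type*} [∀ i, NonUnitalCStarAlgebra (C i)]
    (j : ∀ i, B →⋆ₙₐ[ℂ] C i) (hj : ∀ a b, (∀ i, j i a = j i b) → a = b)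
    (h : ∀ i, G.IsCKFamily (fun A => j i (p A)) (fun e => j i (s e))) : G.IsCKFamily p s where
  projection A :=
    ⟨hj _ _ fun i => by rw [map_mul]; exact ((h i).projection A).1,
      hj _ _ fun i => by rw [map_star]; exact ((h i).projection A).2⟩
  partialIsometry e := hj _ _ fun i => by
    simp only [map_mul, map_star]; exact (h i).partialIsometry e
  orthogonal e f hef := hj _ _ fun i => by
    simp only [map_mul, map_star, map_zero]; exact (h i).orthogonal e f hef
  p_empty := hj _ _ fun i => by rw [map_zero]; exact (h i).p_empty
  p_inter A B := hj _ _ fun i => by rw [map_mul]; exact (h i).p_inter A B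
  p_union A B := hj _ _ fun i => by rw [map_sub, map_add]; exact (h i).p_union A B
  initial e := hj _ _ fun i => by rw [map_mul, map_star]; exact (h i).initial e
  final_le e := hj _ _ fun i => by
    simp only [map_mul, map_star]; exact (h i).final_le e
  vertex_eq_sum v hv := hj _ _ fun i => by
    simp only [map_sum, map_mul, map_star]; exact (h i).vertex_eq_sum v hv

variable (G)

/-- The generators of the ultragraph C⋆-algebra form a Cuntz–Krieger family. -/
theorem CStar.isCKFamily :
    G.IsCKFamily (B := G.CStar) (fun A => UniversalCStar.gen _ _ (Sum.inl A))
      (fun e => UniversalCStar.gen _ _ (Sum.inr e)) :=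
  .of_injective UniversalCStar.ev (fun _ _ => UniversalCStar.ext_ev) fun i => i.relations

/-- The universal property of the ultragraph C⋆-algebra. -/
theorem CStar.existsUnique_lift {B : Type w} [NonUnitalCStarAlgebra B] {p : G.GenVertex → B}
    {s : E → B} (h : G.IsCKFamily p s) :
    ∃! φ : G.CStar →⋆ₙₐ[ℂ] B, (∀ A, φ (UniversalCStar.gen _ _ (Sum.inl A)) = p A) ∧
      ∀ e, φ (UniversalCStar.gen _ _ (Sum.inr e)) = s e := by
  obtain ⟨φ, hφ⟩ := UniversalCStar.exists_lift (X := G.GenVertex ⊕ E)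
    (R := fun _ _ b => G.IsCKFamily (fun A => b (Sum.inl A)) (fun e => b (Sum.inr e)))
    (Sum.elim p s) (by
      rintro (A | e)
      · exact (h.projection A).isPartialIsometry
      · exact h.partialIsometry e)
    (fun C _ j c hj hc => .of_injective (I := Unit) (fun _ => j) (fun a b hab => hj (hab ()))
      fun _ => by simp only [hc]; exact h)
  refine ⟨φ, ⟨fun A => hφ _, fun e => hφ _⟩, fun ψ hψ => UniversalCStar.hom_ext ?_⟩
  rintro (A | e)
  · exact (hψ.1 A).trans (hφ (Sum.inl A)).symm
  · exact (hψ.2 e).trans (hφ (Sum.inr e)).symm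

end Ultragraph

/-! ### Subshifts -/

namespace Subshift

variable {𝓐 : Type v}

/-- The word of length `n` which appears in `x` at position `k`. -/
def block (x : ℕ → 𝓐) (k n : ℕ) : List 𝓐 := List.ofFn fun i : Fin n => x (k + i)

/-- The subshift of all sequences in which no word of `F` appears. -/
def ofForbidden (F : Set (List 𝓐)) : Set (ℕ → 𝓐) := {x | ∀ k n, block x k n ∉ F}

/-- The language of `X`: the initial words of the sequences in `X`. -/
def language (X : Set (ℕ → 𝓐)) : Set (List 𝓐) := {w | ∃ x ∈ X, block x 0 w.length = w}

/-- The empty word is in the language as soon as some word is. -/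
theorem nil_mem_language {X : Set (ℕ → 𝓐)} {w : List 𝓐} (hw : w ∈ language X) :
    [] ∈ language X := by
  obtain ⟨x, hx, -⟩ := hw
  exact ⟨x, hx, rfl⟩

/-- Concatenation of a word and a sequence. -/
def concat : List 𝓐 → (ℕ → 𝓐) → ℕ → 𝓐
  | [], x, n => x n
  | a :: _, _, 0 => a
  | _ :: w, x, n + 1 => concat w x n

/-- `C(α, β) = {β x ∈ X : α x ∈ X}`. -/
def cyl (X : Set (ℕ → 𝓐)) (α β : List 𝓐) : Set (ℕ → 𝓐) :=
  {y | ∃ x, y = concat β x ∧ concat β x ∈ X ∧ concat α x ∈ X}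

/-- Membership in the Boolean algebra of sets (with relative complements, and not necessarily with
`X` as a member) generated by the sets `C(α, β)` with `α`, `β` in the language, not both empty. -/
inductive IsBool (X : Set (ℕ → 𝓐)) : Set (ℕ → 𝓐) → Prop
  | empty : IsBool X ∅
  | cyl {α β : List 𝓐} : α ∈ language X → β ∈ language X → ¬ (α = [] ∧ β = []) →
      IsBool X (cyl X α β)
  | union {A B : Set (ℕ → 𝓐)} : IsBool X A → IsBool X B → IsBool X (A ∪ B)
  | inter {A B : Set (ℕ → 𝓐)} : IsBool X A → IsBool X B → IsBool X (A ∩ B)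
  | diff {A B : Set (ℕ → 𝓐)} : IsBool X A → IsBool X B → IsBool X (A \ B)

/-- The Boolean algebra `𝓑` of a subshift. -/
def BoolAlg (X : Set (ℕ → 𝓐)) : Type v := {A : Set (ℕ → 𝓐) // IsBool X A}

/-- The product `s_α = s_{α₁} ⋯ s_{αₙ}` over a nonempty word (the empty word gets the dummy
value `0`). -/
def wordProd {B : Type w} [NonUnitalCStarAlgebra B] (s : 𝓐 → B) : List 𝓐 → B
  | [] => 0
  | [a] => s a
  | a :: b :: w => s a * wordProd s (b :: w)

/-- The relations between the generators of the subshift C⋆-algebra. -/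
structure IsSubshiftFamily (X : Set (ℕ → 𝓐)) {B : Type w} [NonUnitalCStarAlgebra B]
    (p : BoolAlg X → B) (s : 𝓐 → B) : Prop where
  projection : ∀ A, IsStarProjection (p A)
  partialIsometry : ∀ a, IsPartialIsometry (s a)
  p_inter : ∀ A B : BoolAlg X, p ⟨A.1 ∩ B.1, .inter A.2 B.2⟩ = p A * p B
  p_union : ∀ A B : BoolAlg X,
    p ⟨A.1 ∪ B.1, .union A.2 B.2⟩ = p A + p B - p ⟨A.1 ∩ B.1, .inter A.2 B.2⟩
  p_empty : p ⟨∅, .empty⟩ = 0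
  p_cyl : ∀ (α β : List 𝓐) (hα : α ∈ language X) (hβ : β ∈ language X) (hα' : α ≠ [])
    (_ : β ≠ []), wordProd s β * star (wordProd s α) * wordProd s α * star (wordProd s β) =
      p ⟨cyl X α β, .cyl hα hβ fun h => hα' h.1⟩
  p_follower : ∀ (α : List 𝓐) (hα : α ∈ language X) (hα' : α ≠ []),
    star (wordProd s α) * wordProd s α = p ⟨cyl X α [], .cyl hα (nil_mem_language hα) fun h => hα' h.1⟩
  p_cylinder : ∀ (β : List 𝓐) (hβ : β ∈ language X) (hβ' : β ≠ []),
    wordProd s β * star (wordProd s β) = p ⟨cyl X [] β, .cyl (nil_mem_language hβ) hβ fun h => hβ' h.2⟩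

/-- The (not necessarily unital) C⋆-algebra of a subshift `X`. -/
abbrev CStar (X : Set (ℕ → 𝓐)) : Type (v + 1) :=
  UniversalCStar (BoolAlg X ⊕ 𝓐)
    (fun _ _ b => IsSubshiftFamily X (fun A => b (Sum.inl A)) (fun a => b (Sum.inr a)))

/-- Homomorphisms commute with products over words. -/
theorem map_wordProd {B : Type w} [NonUnitalCStarAlgebra B] {C : Type*} [NonUnitalCStarAlgebra C]
    (j : B →⋆ₙₐ[ℂ] C) (s : 𝓐 → B) : ∀ w, j (wordProd s w) = wordProd (fun a => j (s a)) w
  | [] => map_zero j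
  | [_] => rfl
  | a :: b :: w => by simp only [wordProd, map_mul, map_wordProd j s (b :: w)]

/-- The relations are detected by jointly injective families of homomorphisms. -/
theorem IsSubshiftFamily.of_injective {X : Set (ℕ → 𝓐)} {B : Type w} [NonUnitalCStarAlgebra B]
    {p : BoolAlg X → B} {s : 𝓐 → B} {I : Type*} {C : I → Type*}
    [∀ i, NonUnitalCStarAlgebra (C i)]
    (j : ∀ i, B →⋆ₙₐ[ℂ] C i) (hj : ∀ a b, (∀ i, j i a = j i b) → a = b)
    (h : ∀ i, IsSubshiftFamily X (fun A => j i (p A)) (fun a => j i (s a))) :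
    IsSubshiftFamily X p s where
  projection A :=
    ⟨hj _ _ fun i => by rw [map_mul]; exact ((h i).projection A).1,
      hj _ _ fun i => by rw [map_star]; exact ((h i).projection A).2⟩
  partialIsometry a := hj _ _ fun i => by
    simp only [map_mul, map_star]; exact (h i).partialIsometry a
  p_inter A B := hj _ _ fun i => by rw [map_mul]; exact (h i).p_inter A B
  p_union A B := hj _ _ fun i => by rw [map_sub, map_add]; exact (h i).p_union A B
  p_empty := hj _ _ fun i => by rw [map_zero]; exact (h i).p_empty
  p_cyl α β hα hβ hα' hβ' := hj _ _ fun i => by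
    simp only [map_mul, map_star, map_wordProd]; exact (h i).p_cyl α β hα hβ hα' hβ'
  p_follower α hα hα' := hj _ _ fun i => by
    simp only [map_mul, map_star, map_wordProd]; exact (h i).p_follower α hα hα'
  p_cylinder β hβ hβ' := hj _ _ fun i => by
    simp only [map_mul, map_star, map_wordProd]; exact (h i).p_cylinder β hβ hβ'

/-- The generators of the subshift C⋆-algebra satisfy the relations. -/
theorem CStar.isSubshiftFamily (X : Set (ℕ → 𝓐)) :
    IsSubshiftFamily X (B := CStar X) (fun A => UniversalCStar.gen _ _ (Sum.inl A))
      (fun a => UniversalCStar.gen _ _ (Sum.inr a)) :=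
  .of_injective UniversalCStar.ev (fun _ _ => UniversalCStar.ext_ev) fun i => i.relations

/-- The universal property of the subshift C⋆-algebra. -/
theorem CStar.existsUnique_lift {X : Set (ℕ → 𝓐)} {B : Type w} [NonUnitalCStarAlgebra B]
    {p : BoolAlg X → B} {s : 𝓐 → B} (h : IsSubshiftFamily X p s) :
    ∃! φ : CStar X →⋆ₙₐ[ℂ] B, (∀ A, φ (UniversalCStar.gen _ _ (Sum.inl A)) = p A) ∧
      ∀ a, φ (UniversalCStar.gen _ _ (Sum.inr a)) = s a := by
  obtain ⟨φ, hφ⟩ := UniversalCStar.exists_lift (X := BoolAlg X ⊕ 𝓐)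
    (R := fun _ _ b => IsSubshiftFamily X (fun A => b (Sum.inl A)) (fun a => b (Sum.inr a)))
    (Sum.elim p s) (by
      rintro (A | a)
      · exact (h.projection A).isPartialIsometry
      · exact h.partialIsometry a)
    (fun C _ j c hj hc => .of_injective (I := Unit) (fun _ => j) (fun a b hab => hj (hab ()))
      fun _ => by simp only [hc]; exact h)
  refine ⟨φ, ⟨fun A => hφ _, fun a => hφ _⟩, fun ψ hψ => UniversalCStar.hom_ext ?_⟩
  rintro (A | a)
  · exact (hψ.1 A).trans (hφ (Sum.inl A)).symm
  · exact (hψ.2 a).trans (hφ (Sum.inr a)).symm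

end Subshift

/-- The one-sided edge subshift of an ultragraph, over the alphabet of edges: the forbidden words
are the words `e f` with `s(f) ∉ r(e)`. -/
def Ultragraph.edgeSubshift {V : Type u} {E : Type v} (G : Ultragraph V E) : Set (ℕ → E) :=
  Subshift.ofForbidden {w | ∃ e f, w = [e, f] ∧ G.source f ∉ G.range e}

/-! In one direction, a subshift family yields a Cuntz–Krieger family by sending `A` to the
projection of the set of infinite paths starting in `A`. Regularity makes this set a member of the
Boolean algebra: the paths starting at `v` form a finite disjoint union of cylinders of edges.

The other direction must attach to every set in `𝓑` a projection built from a Cuntz–Krieger family,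
independently of how the set is written. For this, functions on paths are carried along with algebra
elements. The span of the pairs (indicator of `{w x : s(x 0) ∈ A}`, `s_w p_A s_w*`) is closed under
products and star. The crux is `snd_eq_zero_of_mem_pathSpan`: a pair in the span with zero function
has zero algebra element. So the span is the graph of a well-defined *-homomorphism on functions,
and it supplies the required projections.

The crux is proved by induction on word length. For length zero, a combination of the `p_A` is cut
along the Boolean pieces `C \ D`; on a nonempty piece some path detects the coefficient, since every
vertex starts a path. For the step, compression by `s_e` shortens words, so `s_e* a s_e = 0` for
every edge `e`; as `a` commutes with `s_e s_e*`, regularity gives `a p_v = 0` for every vertex `v`.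
Modulo length-zero terms `a` lives on finitely many vertices, and the length-zero case confines the
remainder to them too, so `a = 0`.

The two homomorphisms are mutually inverse by uniqueness of path projections on one side; on the
other, the `s_a` determine all projections of a subshift family (`IsSubshiftFamily.map_p`). -/

namespace Subshift

variable {𝓐 : Type v}

/-! ### Words, sequences and products over words -/

theorem concat_nil (x : ℕ → 𝓐) : concat [] x = x := rfl

theorem concat_cons_zero (a : 𝓐) (w : List 𝓐) (x : ℕ → 𝓐) : concat (a :: w) x 0 = a := rfl

theorem concat_cons_succ (a : 𝓐) (w : List 𝓐) (x : ℕ → 𝓐) (n : ℕ) :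
    concat (a :: w) x (n + 1) = concat w x n := rfl

theorem concat_cons (a : 𝓐) (w : List 𝓐) (x : ℕ → 𝓐) :
    concat (a :: w) x = concat [a] (concat w x) := by
  funext n
  cases n <;> rfl

theorem concat_head_tail (x : ℕ → 𝓐) : concat [x 0] (fun n => x (n + 1)) = x := by
  funext n
  cases n <;> rfl

theorem wordProd_cons {B : Type w} [NonUnitalCStarAlgebra B] (s : 𝓐 → B) (a : 𝓐) {w : List 𝓐}
    (hw : w ≠ []) : wordProd s (a :: w) = s a * wordProd s w := by
  cases w with
  | nil => exact absurd rfl hw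
  | cons b w => rfl

end Subshift

/-! ### Infinite paths of an ultragraph -/

namespace Ultragraph

open Subshift

variable {V : Type u} {E : Type v} {G : Ultragraph V E}

theorem mem_edgeSubshift {x : ℕ → E} :
    x ∈ G.edgeSubshift ↔ ∀ k, G.source (x (k + 1)) ∈ G.range (x k) := by
  constructor
  · intro hx k
    by_contra hk
    exact hx k 2 ⟨x k, x (k + 1), by simp [block], hk⟩
  · rintro hx k n ⟨e, f, he, hf⟩
    have hn : n = 2 := by simpa [block] using congrArg List.length he
    subst hn
    simp only [block, List.ofFn_succ, List.ofFn_zero, List.cons.injEq] at he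
    obtain ⟨rfl, rfl, -⟩ := he
    exact hf (hx k)

theorem concat_cons_mem_edgeSubshift {e : E} {w : List E} {x : ℕ → E} :
    concat (e :: w) x ∈ G.edgeSubshift ↔
      G.source (concat w x 0) ∈ G.range e ∧ concat w x ∈ G.edgeSubshift := by
  rw [mem_edgeSubshift, mem_edgeSubshift]
  -- The condition at `k = 0` is the junction of `e` with the rest; the conditions at `k + 1` say
  -- that the rest is a path.
  exact (Nat.and_forall_add_one
    (p := fun k => G.source (concat (e :: w) x (k + 1)) ∈ G.range (concat (e :: w) x k))).symm

theorem mem_edgeSubshift_of_concat_mem {x : ℕ → E} :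
    ∀ {w : List E}, concat w x ∈ G.edgeSubshift → x ∈ G.edgeSubshift
  | [], h => h
  | _ :: _, h => mem_edgeSubshift_of_concat_mem (concat_cons_mem_edgeSubshift.1 h).2

/-- Every edge is the first edge of an infinite path. -/
theorem exists_mem_edgeSubshift (hG : ∀ v, G.IsRegular v) (e : E) :
    ∃ x ∈ G.edgeSubshift, x 0 = e := by
  have h (f : E) : ∃ g, G.source g ∈ G.range f := by
    obtain ⟨v, hv⟩ := G.range_nonempty f
    obtain ⟨g, hg⟩ := (hG v).1
    exact ⟨g, (show G.source g = v from hg) ▸ hv⟩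
  choose n hn using h
  refine ⟨fun k => n^[k] e, mem_edgeSubshift.2 fun k => ?_, rfl⟩
  rw [Function.iterate_succ_apply']
  exact hn _

theorem exists_mem_edgeSubshift_source (hG : ∀ v, G.IsRegular v) (v : V) :
    ∃ x ∈ G.edgeSubshift, G.source (x 0) = v := by
  obtain ⟨e, he⟩ := (hG v).1
  obtain ⟨x, hx, rfl⟩ := exists_mem_edgeSubshift hG e
  exact ⟨x, hx, he⟩

theorem singleton_mem_language (hG : ∀ v, G.IsRegular v) (e : E) :
    [e] ∈ language G.edgeSubshift := by
  obtain ⟨x, hx, rfl⟩ := exists_mem_edgeSubshift hG e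
  exact ⟨x, hx, by simp [block]⟩

theorem of_cons_mem_language {e f : E} {w : List E}
    (h : e :: f :: w ∈ language G.edgeSubshift) :
    G.source f ∈ G.range e ∧ f :: w ∈ language G.edgeSubshift := by
  obtain ⟨x, hx, hw⟩ := h
  simp only [block, List.length_cons, List.ofFn_succ, List.cons.injEq] at hw
  obtain ⟨rfl, rfl, hw⟩ := hw
  refine ⟨mem_edgeSubshift.1 hx 0, fun n => x (n + 1),
    mem_edgeSubshift.2 fun k => mem_edgeSubshift.1 hx (k + 1), ?_⟩
  simp only [block, List.length_cons, List.ofFn_succ, List.cons.injEq]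
  refine ⟨rfl, ?_⟩
  conv_rhs => rw [← hw]
  congr 1

/-! ### Consequences of the Cuntz–Krieger relations -/

variable (G) in
/-- The range of an edge as a generalized vertex. -/
def rangeVertex (e : E) : G.GenVertex := ⟨G.range e, .range e⟩

variable (G) in
/-- A vertex as a generalized vertex. -/
def singletonVertex (v : V) : G.GenVertex := ⟨{v}, .vertex v⟩

/-- The intersection of generalized vertices. -/
def GenVertex.inter (A C : G.GenVertex) : G.GenVertex := ⟨A.1 ∩ C.1, .inter A.2 C.2⟩

/-- The union of generalized vertices. -/
def GenVertex.union (A C : G.GenVertex) : G.GenVertex := ⟨A.1 ∪ C.1, .union A.2 C.2⟩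

variable (G) in
/-- The empty generalized vertex. -/
def emptyVertex : G.GenVertex := ⟨∅, .empty⟩

namespace IsCKFamily

variable {B : Type w} [NonUnitalCStarAlgebra B] {p : G.GenVertex → B} {s : E → B}
  (h : G.IsCKFamily p s)
include h

theorem star_p (A : G.GenVertex) : star (p A) = p A := (h.projection A).isSelfAdjoint

theorem star_s_mul_s (e : E) : star (s e) * s e = p (G.rangeVertex e) := h.initial e

theorem p_mul_p (A C : G.GenVertex) : p A * p C = p (A.inter C) := h.p_inter A C

theorem p_emptyVertex : p G.emptyVertex = 0 := h.p_empty

theorem s_mul_p_range (e : E) : s e * p (G.rangeVertex e) = s e := by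
  rw [← h.star_s_mul_s, ← mul_assoc]
  exact h.partialIsometry e

theorem p_range_mul_star_s (e : E) : p (G.rangeVertex e) * star (s e) = star (s e) := by
  rw [← h.star_p, ← star_mul, h.s_mul_p_range]

theorem star_s_mul_s_of_ne {e f : E} (hef : e ≠ f) : star (s e) * s f = 0 := by
  have he : s e * star (s e) * s e = s e := h.partialIsometry e
  have hf : s f * star (s f) * s f = s f := h.partialIsometry f
  calc star (s e) * s f = star (s e * star (s e) * s e) * (s f * star (s f) * s f) := by rw [he, hf]
    _ = star (s e) * (s e * star (s e) * (s f * star (s f))) * s f := by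
      simp only [star_mul, star_star, mul_assoc]
    _ = 0 := by rw [h.orthogonal e f hef, mul_zero, zero_mul]

theorem p_source_mul_s (e : E) : p (G.singletonVertex (G.source e)) * s e = s e := by
  have he : s e * star (s e) * s e = s e := h.partialIsometry e
  conv_rhs => rw [← he, ← h.final_le e]
  rw [mul_assoc, he]
  rfl

theorem p_mul_p_of_subset {A C : G.GenVertex} (hAC : C.1 ⊆ A.1) : p A * p C = p C := by
  rw [h.p_mul_p]
  exact congrArg p (Subtype.ext (Set.inter_eq_right.2 hAC))

theorem p_mul_p_of_disjoint {A C : G.GenVertex} (hAC : A.1 ∩ C.1 = ∅) : p A * p C = 0 := by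
  rw [h.p_mul_p, ← h.p_emptyVertex]
  exact congrArg p (Subtype.ext hAC)

theorem p_mul_p_comm (A C : G.GenVertex) : p A * p C = p C * p A := by
  rw [h.p_mul_p, h.p_mul_p]
  exact congrArg p (Subtype.ext (Set.inter_comm _ _))

theorem p_mul_s_of_mem {A : G.GenVertex} {e : E} (he : G.source e ∈ A.1) : p A * s e = s e := by
  rw [← h.p_source_mul_s e, ← mul_assoc,
    h.p_mul_p_of_subset (C := G.singletonVertex (G.source e)) (Set.singleton_subset_iff.2 he)]

theorem p_mul_s_of_notMem {A : G.GenVertex} {e : E} (he : G.source e ∉ A.1) : p A * s e = 0 := by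
  rw [← h.p_source_mul_s e, ← mul_assoc,
    h.p_mul_p_of_disjoint (C := G.singletonVertex (G.source e)) (Set.inter_singleton_eq_empty.2 he),
    zero_mul]

theorem star_s_mul_p_of_mem {A : G.GenVertex} {e : E} (he : G.source e ∈ A.1) :
    star (s e) * p A = star (s e) := by
  rw [← h.star_p, ← star_mul, h.p_mul_s_of_mem he]

theorem star_s_mul_p_of_notMem {A : G.GenVertex} {e : E} (he : G.source e ∉ A.1) :
    star (s e) * p A = 0 := by
  rw [← h.star_p, ← star_mul, h.p_mul_s_of_notMem he, star_zero]

/-- The initial projection of the product over a path is the projection of its range. -/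
theorem exists_wordProd_initial : ∀ (α : List E), α ∈ language G.edgeSubshift → α ≠ [] →
    ∃ A : G.GenVertex, star (wordProd s α) * wordProd s α = p A ∧
      wordProd s α * p A = wordProd s α ∧
      ∀ x, concat α x ∈ G.edgeSubshift ↔ x ∈ G.edgeSubshift ∧ G.source (x 0) ∈ A.1
  | [], _, hα => absurd rfl hα
  | [e], _, _ => ⟨G.rangeVertex e, h.initial e, h.s_mul_p_range e, fun x => by
      rw [concat_cons_mem_edgeSubshift, concat_nil, and_comm]
      rfl⟩
  | e :: f :: w, hα, _ => by
      obtain ⟨hef, hw⟩ := of_cons_mem_language hα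
      obtain ⟨A, h1, h2, h3⟩ := exists_wordProd_initial (f :: w) hw (List.cons_ne_nil _ _)
      -- Membership in the language gives `s(f) ∈ r(e)`, so the middle factor `s_e* s_e = p_{r(e)}`
      -- is absorbed and `A` stays the range of the last edge.
      have hf : p (G.rangeVertex e) * wordProd s (f :: w) = wordProd s (f :: w) := by
        cases w with
        | nil => exact h.p_mul_s_of_mem (A := G.rangeVertex e) hef
        | cons g w =>
          rw [wordProd_cons s f (List.cons_ne_nil g w), ← mul_assoc, h.p_mul_s_of_mem (A := G.rangeVertex e) hef]
      refine ⟨A, ?_, ?_, fun x => ?_⟩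
      · rw [wordProd_cons s e (List.cons_ne_nil f w), star_mul, mul_assoc,
          ← mul_assoc (star (s e)), h.star_s_mul_s, hf, h1]
      · rw [wordProd_cons s e (List.cons_ne_nil f w), mul_assoc, h2]
      · rw [concat_cons_mem_edgeSubshift, h3, concat_cons_zero]
        exact and_iff_right hef

end IsCKFamily

/-! ### The homomorphism into the subshift algebra -/

/-- The infinite paths which start in a given set of vertices. -/
def pathsFrom (G : Ultragraph V E) (A : Set V) : Set (ℕ → E) :=
  {x | x ∈ G.edgeSubshift ∧ G.source (x 0) ∈ A}

theorem cyl_singleton_nil (e : E) : cyl G.edgeSubshift [e] [] = G.pathsFrom (G.range e) := by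
  ext x
  constructor
  · rintro ⟨y, rfl, hy, hey⟩
    exact ⟨hy, (concat_cons_mem_edgeSubshift.1 hey).1⟩
  · rintro ⟨hx, hex⟩
    exact ⟨x, rfl, hx, concat_cons_mem_edgeSubshift.2 ⟨hex, hx⟩⟩

theorem cyl_nil_singleton (e : E) :
    cyl G.edgeSubshift [] [e] = {x | x ∈ G.edgeSubshift ∧ x 0 = e} := by
  ext x
  constructor
  · rintro ⟨y, rfl, hy, -⟩
    exact ⟨hy, rfl⟩
  · rintro ⟨hx, rfl⟩
    refine ⟨fun n => x (n + 1), (concat_head_tail x).symm, (concat_head_tail x).symm ▸ hx, ?_⟩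
    exact mem_edgeSubshift_of_concat_mem (w := [x 0]) ((concat_head_tail x).symm ▸ hx)

theorem isBool_first_edge_mem (hG : ∀ v, G.IsRegular v) (t : Finset E) :
    IsBool G.edgeSubshift {x | x ∈ G.edgeSubshift ∧ x 0 ∈ t} := by
  classical
  induction t using Finset.induction_on with
  | empty => simpa using IsBool.empty
  | insert e t _ ih =>
    have h1 : IsBool G.edgeSubshift (cyl G.edgeSubshift [] [e]) :=
      .cyl (nil_mem_language (singleton_mem_language hG e)) (singleton_mem_language hG e) (by simp)
    rw [cyl_nil_singleton] at h1
    convert h1.union ih using 1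
    ext x
    simp only [Finset.mem_insert, Set.mem_ofPred_eq, Set.mem_union]
    tauto

/-- Finite emission turns a condition on the source into a condition on the first edge, which the
cylinders can express. -/
theorem pathsFrom_singleton {v : V} (hv : {e | G.source e = v}.Finite) :
    G.pathsFrom {v} = {x | x ∈ G.edgeSubshift ∧ x 0 ∈ hv.toFinset} := by
  ext x
  simp [pathsFrom]

theorem isBool_pathsFrom (hG : ∀ v, G.IsRegular v) {A : Set V} (hA : G.IsGenVertex A) :
    IsBool G.edgeSubshift (G.pathsFrom A) := by
  induction hA with
  | empty => simpa [pathsFrom] using IsBool.empty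
  | vertex v =>
    rw [pathsFrom_singleton (hG v).2]
    exact isBool_first_edge_mem hG _
  | range e =>
    rw [← cyl_singleton_nil]
    exact .cyl (singleton_mem_language hG e) (nil_mem_language (singleton_mem_language hG e))
      (by simp)
  | @union A C _ _ ihA ihC =>
    convert ihA.union ihC using 1
    ext x
    simp only [pathsFrom, Set.mem_ofPred_eq, Set.mem_union]
    tauto
  | @inter A C _ _ ihA ihC =>
    convert ihA.inter ihC using 1
    ext x
    simp only [pathsFrom, Set.mem_ofPred_eq, Set.mem_inter_iff]
    tauto

/-- The generators of the subshift algebra give a Cuntz–Krieger family. -/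
theorem isCKFamily_of_isSubshiftFamily (hG : ∀ v, G.IsRegular v) {B : Type w}
    [NonUnitalCStarAlgebra B] {p : BoolAlg G.edgeSubshift → B} {s : E → B}
    (h : IsSubshiftFamily G.edgeSubshift p s) :
    G.IsCKFamily (fun A => p ⟨G.pathsFrom A.1, isBool_pathsFrom hG A.2⟩) s := by
  classical
  have congr_p {A C : BoolAlg G.edgeSubshift} (hAC : A.1 = C.1) : p A = p C :=
    congrArg p (Subtype.ext hAC)
  have mul_p {A C D : BoolAlg G.edgeSubshift} (hD : A.1 ∩ C.1 = D.1) : p A * p C = p D :=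
    (h.p_inter A C).symm.trans (congr_p hD)
  have final (e : E) : s e * star (s e) = p ⟨_, isBool_first_edge_mem hG {e}⟩ :=
    (h.p_cylinder [e] (singleton_mem_language hG e) (by simp)).trans
      (congr_p ((cyl_nil_singleton e).trans (by simp)))
  -- Cylinders of distinct edges are disjoint, so the union relation becomes additivity; for the
  -- edges leaving `v` this is the Cuntz–Krieger sum.
  have sum (t : Finset E) :
      p ⟨_, isBool_first_edge_mem hG t⟩ = ∑ e ∈ t, s e * star (s e) := by
    induction t using Finset.induction_on with
    | empty =>
      rw [Finset.sum_empty, ← h.p_empty]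
      exact congr_p (by simp)
    | insert e t het ih =>
      rw [Finset.sum_insert het, ← ih, final]
      have h1 := h.p_union ⟨_, isBool_first_edge_mem hG {e}⟩ ⟨_, isBool_first_edge_mem hG t⟩
      have h2 : ({x | x ∈ G.edgeSubshift ∧ x 0 ∈ ({e} : Finset E)} ∩
          {x | x ∈ G.edgeSubshift ∧ x 0 ∈ t} : Set (ℕ → E)) = ∅ := by
        ext x
        simp only [Finset.mem_singleton, Set.mem_inter_iff, Set.mem_ofPred_eq,
          Set.mem_empty_iff_false, iff_false]
        rintro ⟨⟨-, rfl⟩, -, hx⟩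
        exact het hx
      refine Eq.trans (congr_p ?_) (h1.trans ((congrArg _ ((congr_p h2).trans h.p_empty)).trans
        (sub_zero _)))
      ext x
      simp only [Finset.mem_insert, Finset.mem_singleton, Set.mem_ofPred_eq, Set.mem_union]
      tauto
  refine
    { projection := fun A => h.projection _
      partialIsometry := h.partialIsometry
      orthogonal := fun e f hef => ?_
      p_empty := (congr_p (by simp [pathsFrom])).trans h.p_empty
      p_inter := fun A C => ?_
      p_union := fun A C => ?_
      initial := fun e => ?_
      final_le := fun e => ?_
      vertex_eq_sum := fun v hv => ?_ }
  · refine (congrArg₂ _ (final e) (final f)).trans ((mul_p ?_).trans h.p_empty)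
    ext x
    simp only [Finset.mem_singleton, Set.mem_inter_iff, Set.mem_ofPred_eq,
      Set.mem_empty_iff_false, iff_false]
    rintro ⟨⟨-, rfl⟩, -, hx⟩
    exact hef hx
  · refine mul_p ?_
    ext x
    simp only [pathsFrom, Set.mem_ofPred_eq, Set.mem_inter_iff]
    tauto
  · refine Eq.trans (congr_p ?_) ((h.p_union _ _).trans (congrArg _ (congr_p ?_))) <;>
    · ext x
      simp only [pathsFrom, Set.mem_ofPred_eq, Set.mem_inter_iff, Set.mem_union]
      tauto
  · exact (h.p_follower [e] (singleton_mem_language hG e) (by simp)).trans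
      (congr_p (cyl_singleton_nil e))
  · rw [final]
    refine mul_p (Set.inter_eq_right.2 ?_)
    rintro x ⟨hx, hxe⟩
    exact ⟨hx, by rw [Finset.mem_singleton.1 hxe]; rfl⟩
  · rw [← sum]
    exact congr_p (pathsFrom_singleton hv.2)

/-! ### Functions on paths paired with elements of the algebra -/

section Pairs

variable {B : Type w} [NonUnitalCStarAlgebra B]

/-- The indicator function of the paths which start in `A`, paired with the projection of `A`. -/
noncomputable def vertexPair (p : G.GenVertex → B) (A : G.GenVertex) : ((ℕ → E) → ℂ) × B :=
  (Set.indicator (G.pathsFrom A.1) 1, p A)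

/-- Transport of functions on paths along `x ↦ e x`, paired with `b ↦ s_e b s_e*`. -/
noncomputable def consPair (G : Ultragraph V E) (s : E → B) (e : E) :
    ((ℕ → E) → ℂ) × B →ₗ[ℂ] ((ℕ → E) → ℂ) × B where
  toFun a := (Set.indicator {y | y ∈ G.edgeSubshift ∧ y 0 = e} fun y => a.1 fun n => y (n + 1),
    s e * a.2 * star (s e))
  map_add' a b := Prod.ext (Set.indicator_add _ _ _) (by simp [mul_add, add_mul])
  map_smul' c a := Prod.ext (Set.indicator_const_smul _ c _)
    (by simp [mul_smul_comm, smul_mul_assoc])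

/-- Composition of functions on paths with `x ↦ e x`, paired with `b ↦ s_e* b s_e`. -/
noncomputable def extPair (G : Ultragraph V E) (s : E → B) (e : E) :
    ((ℕ → E) → ℂ) × B →ₗ[ℂ] ((ℕ → E) → ℂ) × B where
  toFun a := (Set.indicator {x | concat [e] x ∈ G.edgeSubshift} fun x => a.1 (concat [e] x),
    star (s e) * a.2 * s e)
  map_add' a b := Prod.ext (Set.indicator_add _ _ _) (by simp [mul_add, add_mul])
  map_smul' c a := Prod.ext (Set.indicator_const_smul _ c _)
    (by simp [mul_smul_comm, smul_mul_assoc])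

/-- The indicator function of the paths `w x` with `x` starting in `A`, paired with the projection
`s_w p_A s_w*`. -/
noncomputable def wordPair (p : G.GenVertex → B) (s : E → B) (A : G.GenVertex) :
    List E → ((ℕ → E) → ℂ) × B
  | [] => vertexPair p A
  | e :: w => consPair G s e (wordPair p s A w)

/-- The span of the pairs of words of length at most `n`. -/
noncomputable def pathSpan (p : G.GenVertex → B) (s : E → B) (n : ℕ) :
    Submodule ℂ (((ℕ → E) → ℂ) × B) :=
  Submodule.span ℂ {a | ∃ A w, w.length ≤ n ∧ wordPair p s A w = a}

theorem consPair_fst_apply (s : E → B) (e : E) (a : ((ℕ → E) → ℂ) × B) (y : ℕ → E) :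
    (consPair G s e a).1 y =
      Set.indicator {y | y ∈ G.edgeSubshift ∧ y 0 = e} (fun y => a.1 fun n => y (n + 1)) y := rfl

theorem consPair_snd (s : E → B) (e : E) (a : ((ℕ → E) → ℂ) × B) :
    (consPair G s e a).2 = s e * a.2 * star (s e) := rfl

theorem extPair_fst_apply (s : E → B) (e : E) (a : ((ℕ → E) → ℂ) × B) (x : ℕ → E) :
    (extPair G s e a).1 x =
      Set.indicator {x | concat [e] x ∈ G.edgeSubshift} (fun x => a.1 (concat [e] x)) x := rfl

theorem extPair_snd (s : E → B) (e : E) (a : ((ℕ → E) → ℂ) × B) :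
    (extPair G s e a).2 = star (s e) * a.2 * s e := rfl

variable {p : G.GenVertex → B} {s : E → B}

theorem wordPair_mem_pathSpan (A : G.GenVertex) {w : List E} {n : ℕ} (hw : w.length ≤ n) :
    wordPair p s A w ∈ pathSpan p s n :=
  Submodule.subset_span ⟨A, w, hw, rfl⟩

theorem pathSpan_mono : Monotone (pathSpan p s) := fun _ _ hmn =>
  Submodule.span_mono fun _ ⟨A, w, hw, ha⟩ => ⟨A, w, hw.trans hmn, ha⟩

theorem star_consPair (e : E) (a : ((ℕ → E) → ℂ) × B) :
    star (consPair G s e a) = consPair G s e (star a) := by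
  classical
  refine Prod.ext ?_ ?_
  · funext y
    simp only [Prod.fst_star, Pi.star_apply, consPair_fst_apply, Set.indicator_apply]
    split_ifs <;> simp
  · simp only [Prod.snd_star, consPair_snd, star_mul, star_star, mul_assoc]

/-! ### Multiplication and compression of pairs -/

namespace IsCKFamily

variable (h : G.IsCKFamily p s)
include h

theorem vertexPair_mul_vertexPair (A C : G.GenVertex) :
    vertexPair p A * vertexPair p C = vertexPair p (A.inter C) := by
  classical
  refine Prod.ext ?_ (h.p_mul_p A C)
  funext x
  simp only [vertexPair, Prod.fst_mul, Pi.mul_apply, Set.indicator_apply, pathsFrom,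
    GenVertex.inter, Set.mem_ofPred_eq, Set.mem_inter_iff, Pi.one_apply]
  split_ifs <;> first | (exfalso; tauto) | simp

theorem vertexPair_emptyVertex : vertexPair p G.emptyVertex = 0 := by
  refine Prod.ext ?_ h.p_emptyVertex
  funext x
  simp [vertexPair, emptyVertex, pathsFrom]

theorem wordPair_emptyVertex : ∀ w, wordPair p s G.emptyVertex w = 0
  | [] => h.vertexPair_emptyVertex
  | e :: w => by rw [wordPair, wordPair_emptyVertex w, map_zero]

theorem star_wordPair (A : G.GenVertex) : ∀ w, star (wordPair p s A w) = wordPair p s A w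
  | [] => by
    classical
    refine Prod.ext ?_ (h.star_p A)
    funext x
    simp only [wordPair, vertexPair, Prod.fst_star, Pi.star_apply, Set.indicator_apply]
    split_ifs <;> simp
  | e :: w => by rw [wordPair, star_consPair, star_wordPair A w]

theorem vertexPair_mul_consPair_of_mem {A : G.GenVertex} {e : E} (he : G.source e ∈ A.1)
    (a : ((ℕ → E) → ℂ) × B) : vertexPair p A * consPair G s e a = consPair G s e a := by
  classical
  refine Prod.ext ?_ ?_
  · funext y
    simp only [vertexPair, Prod.fst_mul, Pi.mul_apply, consPair_fst_apply, Set.indicator_apply,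
      pathsFrom, Set.mem_ofPred_eq, Pi.one_apply]
    by_cases hy : y ∈ G.edgeSubshift ∧ y 0 = e
    · rw [if_pos hy, if_pos ⟨hy.1, hy.2 ▸ he⟩, one_mul]
    · rw [if_neg hy, mul_zero]
  · simp only [vertexPair, Prod.snd_mul, consPair_snd, ← mul_assoc, h.p_mul_s_of_mem he]

theorem vertexPair_mul_consPair_of_notMem {A : G.GenVertex} {e : E} (he : G.source e ∉ A.1)
    (a : ((ℕ → E) → ℂ) × B) : vertexPair p A * consPair G s e a = 0 := by
  classical
  refine Prod.ext ?_ ?_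
  · funext y
    simp only [vertexPair, Prod.fst_mul, Pi.mul_apply, consPair_fst_apply, Set.indicator_apply,
      pathsFrom, Set.mem_ofPred_eq, Pi.one_apply]
    by_cases hy : y ∈ G.edgeSubshift ∧ y 0 = e
    · rw [if_neg fun hA => he (hy.2 ▸ hA.2), zero_mul]; rfl
    · rw [if_neg hy, mul_zero]; rfl
  · simp only [vertexPair, Prod.snd_mul, consPair_snd, ← mul_assoc, h.p_mul_s_of_notMem he,
      zero_mul, Prod.snd_zero]

theorem star_vertexPair (A : G.GenVertex) : star (vertexPair p A) = vertexPair p A :=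
  h.star_wordPair A []

theorem consPair_mul_vertexPair_of_mem {A : G.GenVertex} {e : E} (he : G.source e ∈ A.1)
    (a : ((ℕ → E) → ℂ) × B) : consPair G s e a * vertexPair p A = consPair G s e a := by
  have h1 := congrArg star (h.vertexPair_mul_consPair_of_mem he (star a))
  rwa [star_mul, star_consPair, star_star, h.star_vertexPair] at h1

theorem consPair_mul_consPair_of_ne {e f : E} (hef : e ≠ f) (a b : ((ℕ → E) → ℂ) × B) :
    consPair G s e a * consPair G s f b = 0 := by
  classical
  refine Prod.ext ?_ ?_
  · funext y
    simp only [Prod.fst_mul, Pi.mul_apply, consPair_fst_apply, Set.indicator_apply,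
      Set.mem_ofPred_eq]
    by_cases hy : y ∈ G.edgeSubshift ∧ y 0 = e
    · rw [if_neg fun hf : y ∈ G.edgeSubshift ∧ y 0 = f => hef (hy.2.symm.trans hf.2), mul_zero]; rfl
    · rw [if_neg hy, zero_mul]; rfl
  · simp only [Prod.snd_mul, consPair_snd, mul_assoc]
    rw [← mul_assoc (star (s e)), h.star_s_mul_s_of_ne hef]
    simp

theorem consPair_mul_consPair (e : E) (a b : ((ℕ → E) → ℂ) × B) :
    consPair G s e a * consPair G s e b =
      consPair G s e (a * (vertexPair p (G.rangeVertex e) * b)) := by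
  classical
  refine Prod.ext ?_ ?_
  · funext y
    simp only [Prod.fst_mul, Pi.mul_apply, consPair_fst_apply, Set.indicator_apply,
      Set.mem_ofPred_eq]
    by_cases hy : y ∈ G.edgeSubshift ∧ y 0 = e
    · have hy' : (fun n => y (n + 1)) ∈ G.pathsFrom (G.rangeVertex e).1 := by
        obtain ⟨hy, rfl⟩ := hy
        exact ⟨mem_edgeSubshift.2 fun k => mem_edgeSubshift.1 hy (k + 1), mem_edgeSubshift.1 hy 0⟩
      simp only [if_pos hy, vertexPair, Set.indicator_of_mem hy', Pi.one_apply, one_mul]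
    · simp only [if_neg hy, zero_mul]
  · simp only [Prod.snd_mul, consPair_snd, vertexPair, ← h.star_s_mul_s, mul_assoc]

theorem extPair_vertexPair_of_mem {A : G.GenVertex} {e : E} (he : G.source e ∈ A.1) :
    extPair G s e (vertexPair p A) = vertexPair p (G.rangeVertex e) := by
  classical
  refine Prod.ext ?_ ?_
  · funext x
    simp only [extPair_fst_apply, vertexPair, Set.indicator_apply, Set.mem_ofPred_eq, pathsFrom,
      concat_cons_mem_edgeSubshift, concat_nil, concat_cons_zero, he, and_true, Pi.one_apply,
      rangeVertex]
    split_ifs <;> first | rfl | tauto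
  · simp only [extPair_snd, vertexPair, h.star_s_mul_p_of_mem he, h.star_s_mul_s]

theorem extPair_vertexPair_of_notMem {A : G.GenVertex} {e : E} (he : G.source e ∉ A.1) :
    extPair G s e (vertexPair p A) = 0 := by
  classical
  refine Prod.ext ?_ ?_
  · funext x
    simp only [extPair_fst_apply, vertexPair, Set.indicator_apply, Set.mem_ofPred_eq, pathsFrom,
      concat_cons_zero, he, and_false, if_false, ite_self]
    rfl
  · simp only [extPair_snd, vertexPair, h.star_s_mul_p_of_notMem he, zero_mul, Prod.snd_zero]

theorem extPair_consPair_of_ne {e f : E} (hef : e ≠ f) (a : ((ℕ → E) → ℂ) × B) :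
    extPair G s e (consPair G s f a) = 0 := by
  classical
  refine Prod.ext ?_ ?_
  · funext x
    simp only [extPair_fst_apply, consPair_fst_apply, Set.indicator_apply, Set.mem_ofPred_eq,
      concat_cons_zero, hef, and_false, if_false, ite_self]
    rfl
  · simp only [extPair_snd, consPair_snd, ← mul_assoc, h.star_s_mul_s_of_ne hef, zero_mul,
      Prod.snd_zero]

theorem extPair_consPair (e : E) (a : ((ℕ → E) → ℂ) × B) :
    extPair G s e (consPair G s e a) =
      vertexPair p (G.rangeVertex e) * (a * vertexPair p (G.rangeVertex e)) := by
  classical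
  refine Prod.ext ?_ ?_
  · funext x
    simp only [extPair_fst_apply, consPair_fst_apply, Set.indicator_apply, Set.mem_ofPred_eq,
      concat_cons_zero, and_true, concat_cons_succ, concat_nil, Prod.fst_mul, Pi.mul_apply,
      vertexPair, concat_cons_mem_edgeSubshift, pathsFrom, rangeVertex]
    split_ifs <;> first | (exfalso; tauto) | simp
  · simp only [extPair_snd, consPair_snd, Prod.snd_mul, vertexPair, ← h.star_s_mul_s, mul_assoc]

/-- On a nonempty word the product depends only on whether the source of the first edge lies in `A`;
a zero product is recorded as the pair of the empty generalized vertex. -/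
theorem exists_vertexPair_mul_wordPair (A C : G.GenVertex) (w : List E) :
    ∃ D, vertexPair p A * wordPair p s C w = wordPair p s D w := by
  cases w with
  | nil => exact ⟨A.inter C, h.vertexPair_mul_vertexPair A C⟩
  | cons e w =>
    by_cases he : G.source e ∈ A.1
    · exact ⟨C, h.vertexPair_mul_consPair_of_mem he _⟩
    · exact ⟨G.emptyVertex, (h.vertexPair_mul_consPair_of_notMem he _).trans
        (h.wordPair_emptyVertex _).symm⟩

theorem exists_wordPair_mul_vertexPair (A C : G.GenVertex) (w : List E) :
    ∃ D, wordPair p s C w * vertexPair p A = wordPair p s D w := by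
  obtain ⟨D, hD⟩ := h.exists_vertexPair_mul_wordPair A C w
  refine ⟨D, ?_⟩
  rw [← h.star_wordPair D, ← hD, star_mul, h.star_wordPair, h.star_vertexPair]

/-- Equal first edges are stripped off both words until one is exhausted or two edges differ. In the
latter case the ranges are orthogonal and the product vanishes. -/
theorem exists_wordPair_mul_wordPair (A C : G.GenVertex) (w t : List E) :
    ∃ D r, wordPair p s A w * wordPair p s C t = wordPair p s D r := by
  induction w generalizing C t with
  | nil => exact (h.exists_vertexPair_mul_wordPair A C t).imp fun D hD => ⟨t, hD⟩
  | cons e w ih =>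
    cases t with
    | nil => exact (h.exists_wordPair_mul_vertexPair C A (e :: w)).imp fun D hD => ⟨_, hD⟩
    | cons f t =>
      by_cases hef : e = f
      · subst hef
        obtain ⟨D, hD⟩ := h.exists_vertexPair_mul_wordPair (G.rangeVertex e) C t
        obtain ⟨D', r, hr⟩ := ih D t
        refine ⟨D', e :: r, ?_⟩
        rw [wordPair, wordPair, wordPair, h.consPair_mul_consPair, hD, hr]
      · exact ⟨G.emptyVertex, [], (h.consPair_mul_consPair_of_ne hef _ _).trans
          (h.wordPair_emptyVertex _).symm⟩

theorem star_mem_pathSpan {n : ℕ} {a : ((ℕ → E) → ℂ) × B} (ha : a ∈ pathSpan p s n) :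
    star a ∈ pathSpan p s n := by
  induction ha using Submodule.span_induction with
  | mem a ha =>
    obtain ⟨A, w, hw, rfl⟩ := ha
    rw [h.star_wordPair]
    exact wordPair_mem_pathSpan A hw
  | zero => rw [star_zero]; exact zero_mem _
  | add a b _ _ iha ihb => rw [star_add]; exact add_mem iha ihb
  | smul c a _ iha => rw [star_smul]; exact Submodule.smul_mem _ _ iha

theorem mul_vertexPair_mem_pathSpan {n : ℕ} {a : ((ℕ → E) → ℂ) × B} (ha : a ∈ pathSpan p s n)
    (A : G.GenVertex) : a * vertexPair p A ∈ pathSpan p s n := by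
  induction ha using Submodule.span_induction with
  | mem a ha =>
    obtain ⟨C, w, hw, rfl⟩ := ha
    obtain ⟨D, hD⟩ := h.exists_wordPair_mul_vertexPair A C w
    rw [hD]
    exact wordPair_mem_pathSpan D hw
  | zero => rw [zero_mul]; exact zero_mem _
  | add a b _ _ iha ihb => rw [add_mul]; exact add_mem iha ihb
  | smul c a _ iha => rw [smul_mul_assoc]; exact Submodule.smul_mem _ _ iha

theorem exists_mul_mem_pathSpan {m n : ℕ} {a b : ((ℕ → E) → ℂ) × B} (ha : a ∈ pathSpan p s m)
    (hb : b ∈ pathSpan p s n) : ∃ k, a * b ∈ pathSpan p s k := by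
  induction ha using Submodule.span_induction with
  | mem a ha =>
    obtain ⟨A, w, -, rfl⟩ := ha
    induction hb using Submodule.span_induction with
    | mem b hb =>
      obtain ⟨C, t, -, rfl⟩ := hb
      obtain ⟨D, r, hr⟩ := h.exists_wordPair_mul_wordPair A C w t
      exact ⟨_, hr ▸ wordPair_mem_pathSpan D le_rfl⟩
    | zero => exact ⟨0, by rw [mul_zero]; exact zero_mem _⟩
    | add b c _ _ ihb ihc =>
      obtain ⟨k, hk⟩ := ihb
      obtain ⟨l, hl⟩ := ihc
      exact ⟨max k l, by
        rw [mul_add]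
        exact add_mem (pathSpan_mono (le_max_left _ _) hk) (pathSpan_mono (le_max_right _ _) hl)⟩
    | smul c b _ ihb =>
      obtain ⟨k, hk⟩ := ihb
      exact ⟨k, by rw [mul_smul_comm]; exact Submodule.smul_mem _ _ hk⟩
  | zero => exact ⟨0, by rw [zero_mul]; exact zero_mem _⟩
  | add a c _ _ iha ihc =>
    obtain ⟨k, hk⟩ := iha
    obtain ⟨l, hl⟩ := ihc
    exact ⟨max k l, by
      rw [add_mul]
      exact add_mem (pathSpan_mono (le_max_left _ _) hk) (pathSpan_mono (le_max_right _ _) hl)⟩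
  | smul c a _ iha =>
    obtain ⟨k, hk⟩ := iha
    exact ⟨k, by rw [smul_mul_assoc]; exact Submodule.smul_mem _ _ hk⟩

/-- This is what drives the induction on length: `s_e* (s_e b s_e*) s_e = p_{r(e)} b p_{r(e)}`
removes a letter, while `s_e* p_A s_e` is `p_{r(e)}` or `0` and still has length zero. -/
theorem extPair_mem_pathSpan {n : ℕ} (e : E) {a : ((ℕ → E) → ℂ) × B}
    (ha : a ∈ pathSpan p s (n + 1)) : extPair G s e a ∈ pathSpan p s n := by
  induction ha using Submodule.span_induction with
  | mem a ha =>
    obtain ⟨A, w, hw, rfl⟩ := ha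
    cases w with
    | nil =>
      by_cases he : G.source e ∈ A.1
      · rw [wordPair, h.extPair_vertexPair_of_mem he]
        exact wordPair_mem_pathSpan (w := []) _ n.zero_le
      · rw [wordPair, h.extPair_vertexPair_of_notMem he]
        exact zero_mem _
    | cons f w =>
      by_cases hef : e = f
      · subst hef
        obtain ⟨D, hD⟩ := h.exists_wordPair_mul_vertexPair (G.rangeVertex e) A w
        obtain ⟨D', hD'⟩ := h.exists_vertexPair_mul_wordPair (G.rangeVertex e) D w
        rw [wordPair, h.extPair_consPair, hD, hD']
        exact wordPair_mem_pathSpan D' (Nat.le_of_succ_le_succ hw)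
      · rw [wordPair, h.extPair_consPair_of_ne hef]
        exact zero_mem _
  | zero => rw [map_zero]; exact zero_mem _
  | add a b _ _ iha ihb => rw [map_add]; exact add_mem iha ihb
  | smul c a _ iha => rw [map_smul]; exact Submodule.smul_mem _ _ iha

/-- Needed to pass from `s_e* a s_e = 0` to `a s_e s_e* = 0`. -/
theorem commute_of_mem_pathSpan {n : ℕ} (e : E) {a : ((ℕ → E) → ℂ) × B}
    (ha : a ∈ pathSpan p s n) : Commute a.2 (s e * star (s e)) := by
  induction ha using Submodule.span_induction with
  | mem a ha =>
    obtain ⟨A, w, -, rfl⟩ := ha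
    cases w with
    | nil =>
      simp only [wordPair, vertexPair, Commute, SemiconjBy]
      by_cases he : G.source e ∈ A.1
      · rw [← mul_assoc, h.p_mul_s_of_mem he, mul_assoc, h.star_s_mul_p_of_mem he]
      · rw [← mul_assoc, h.p_mul_s_of_notMem he, mul_assoc, h.star_s_mul_p_of_notMem he, zero_mul,
          mul_zero]
    | cons f w =>
      simp only [wordPair, consPair_snd, Commute, SemiconjBy, mul_assoc]
      by_cases hef : f = e
      · subst hef
        rw [← mul_assoc (star (s f)), h.star_s_mul_s, h.p_range_mul_star_s,
          ← mul_assoc (star (s f)), h.star_s_mul_s, ← mul_assoc (s f) (p _), h.s_mul_p_range]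
      · rw [← mul_assoc (star (s f)), h.star_s_mul_s_of_ne hef, ← mul_assoc (star (s e)),
          h.star_s_mul_s_of_ne (Ne.symm hef)]
        simp
  | zero => exact Commute.zero_left _
  | add a b _ _ iha ihb => exact iha.add_left ihb
  | smul c a _ iha => exact iha.smul_left c

/-! ### The function of a pair determines the element of the algebra -/

/-- The element `p C - p C * p D` plays the role of the projection of `C \ D`, which need not be a
generalized vertex. The scalar `c` collects the coefficients of the sets already known to contain
the current piece; it and the piece must vary in the induction. -/
theorem smul_add_mul_eq_zero_of_mem_span [DecidableEq G.GenVertex] (t : Finset G.GenVertex)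
    {a : ((ℕ → E) → ℂ) × B} (ha : a ∈ Submodule.span ℂ (vertexPair p '' (t : Set G.GenVertex)))
    (c : ℂ) (C D : G.GenVertex)
    (hz : ∀ x ∈ G.pathsFrom C.1, x ∉ G.pathsFrom D.1 → c + a.1 x = 0)
    (hG : ∀ v, G.IsRegular v) :
    c • (p C - p C * p D) + a.2 * (p C - p C * p D) = 0 := by
  induction t using Finset.induction_on generalizing a c C D with
  | empty =>
    have ha' : a = 0 := by simpa using ha
    subst ha'
    by_cases hc : c = 0
    · simp [hc]
    -- With `c ≠ 0` no path may start in `C \ D`; every vertex starts a path, so this piece is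
    -- empty.
    · have hCD : C.1 ⊆ D.1 := fun v hv => by
        obtain ⟨x, hx, rfl⟩ := exists_mem_edgeSubshift_source hG v
        by_contra hD
        exact hc (by simpa using hz x ⟨hx, hv⟩ fun hxD => hD hxD.2)
      rw [h.p_mul_p_comm, h.p_mul_p_of_subset hCD]
      simp
  | insert A t _ ih =>
    rw [Finset.coe_insert, Set.image_insert_eq, Submodule.mem_span_insert] at ha
    obtain ⟨c', a, ha, rfl⟩ := ha
    -- The piece `C \ D` is split along `A`. Inside `A` the coefficient `c'` joins the scalar;
    -- outside `A`, treated in `h2`, it drops out.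
    have h1 := ih ha (c + c') (C.inter A) D fun x hx hxD => by
      have hxA : x ∈ G.pathsFrom A.1 := ⟨hx.1, hx.2.2⟩
      have := hz x ⟨hx.1, hx.2.1⟩ hxD
      simpa [vertexPair, Set.indicator_of_mem hxA, add_assoc] using this
    have h2 := ih ha c C (D.union A) fun x hx hxD => by
      have hxA : x ∉ G.pathsFrom A.1 := fun hA => hxD ⟨hA.1, .inr hA.2⟩
      have := hz x hx fun hD => hxD ⟨hD.1, .inl hD.2⟩
      simpa [vertexPair, Set.indicator_of_notMem hxA] using this
    have hU : p (D.union A) = p D + p A - p D * p A := by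
      rw [h.p_mul_p]
      exact h.p_union D A
    have hq : p A * (p C - p C * p D) = p C * p A - p C * p A * p D := by
      rw [mul_sub, ← mul_assoc, h.p_mul_p_comm A C]
    have hr : p C - p C * p (D.union A) =
        (p C - p C * p D) - (p C * p A - p C * p A * p D) := by
      rw [hU, mul_assoc (p C) (p A), h.p_mul_p_comm A D]
      simp only [mul_add, mul_sub]
      abel
    rw [← h.p_mul_p] at h1
    rw [hr] at h2
    have h3 := congrArg₂ (· + ·) h1 h2
    simp only [add_smul, smul_sub, mul_sub, add_zero] at h3
    simp only [Prod.snd_add, Prod.smul_snd, add_mul, smul_mul_assoc, vertexPair, hq]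
    simp only [smul_sub, mul_sub]
    rw [← h3]
    abel

theorem snd_eq_zero_of_mem_pathSpan_zero (hG : ∀ v, G.IsRegular v) {a : ((ℕ → E) → ℂ) × B}
    (ha : a ∈ pathSpan p s 0) (ha1 : a.1 = 0) : a.2 = 0 := by
  classical
  have hspan {b : ((ℕ → E) → ℂ) × B} (hb : b ∈ pathSpan p s 0) :
      b ∈ Submodule.span ℂ (Set.range (vertexPair p)) := by
    refine Submodule.span_mono ?_ hb
    rintro _ ⟨A, w, hw, rfl⟩
    rw [List.eq_nil_of_length_eq_zero (Nat.le_zero.1 hw)]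
    exact ⟨A, rfl⟩
  obtain ⟨T, hT, haT⟩ := Submodule.mem_span_finite_of_mem_span (hspan ha)
  obtain ⟨t, rfl⟩ : ∃ t : Finset G.GenVertex, t.image (vertexPair p) = T := by
    rw [← Set.image_univ] at hT
    obtain ⟨t, -, ht⟩ := Finset.subset_set_image_iff.1 hT
    exact ⟨t, ht⟩
  rw [Finset.coe_image] at haT
  have hC (C : G.GenVertex) : a.2 * p C = 0 := by
    -- With `c = 0` and `D = ∅` the piece is all of `C`.
    have := h.smul_add_mul_eq_zero_of_mem_span t haT 0 C G.emptyVertex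
      (fun x _ _ => by simp [ha1]) hG
    simpa [h.p_emptyVertex] using this
  have hb {b : ((ℕ → E) → ℂ) × B} (hb : b ∈ Submodule.span ℂ (Set.range (vertexPair p))) :
      a.2 * b.2 = 0 := by
    induction hb using Submodule.span_induction with
    | mem b hb => obtain ⟨C, rfl⟩ := hb; exact hC C
    | zero => simp
    | add b c _ _ ihb ihc => rw [Prod.snd_add, mul_add, ihb, ihc, add_zero]
    | smul c b _ ihb => rw [Prod.smul_snd, mul_smul_comm, ihb, smul_zero]
  -- Since `star a` is itself a combination of vertex pairs, `a.2 * star a.2 = 0`, and the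
  -- C⋆-identity applies.
  exact CStarRing.mul_star_self_eq_zero_iff a.2 |>.1 (hb (hspan (h.star_mem_pathSpan ha)))

theorem mul_p_eq_zero_of_finite {b : B} (hb : ∀ v, b * p (G.singletonVertex v) = 0) {F : Set V}
    (hF : F.Finite) : ∃ hF' : G.IsGenVertex F, b * p ⟨F, hF'⟩ = 0 := by
  induction F, hF using Set.Finite.induction_on with
  | empty => exact ⟨.empty, (congrArg (b * ·) h.p_empty).trans (mul_zero b)⟩
  | @insert v S _ _ ih =>
    obtain ⟨hS, hbS⟩ := ih
    refine ⟨.union (.vertex v) hS, ?_⟩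
    have h1 := (h.p_union (G.singletonVertex v) ⟨S, hS⟩).trans
      (congrArg _ (h.p_inter (G.singletonVertex v) ⟨S, hS⟩).symm)
    refine (congrArg (b * ·) h1).trans ?_
    simp only [mul_sub, mul_add, ← mul_assoc, hb]
    rw [zero_mul, sub_zero, zero_add]
    exact hbS

/-- Terms of positive length live at the source of their first edge, and a combination has only
finitely many of them. Only the length-zero part `b` can involve infinitely many vertices. -/
theorem exists_eq_add_of_mem_pathSpan {n : ℕ} {a : ((ℕ → E) → ℂ) × B}
    (ha : a ∈ pathSpan p s n) : ∃ b ∈ pathSpan p s 0, ∃ d, ∃ F : G.GenVertex, F.1.Finite ∧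
      a = b + d ∧ d * vertexPair p F = d := by
  induction ha using Submodule.span_induction with
  | mem a ha =>
    obtain ⟨A, w, -, rfl⟩ := ha
    cases w with
    | nil => exact ⟨_, wordPair_mem_pathSpan (w := []) A le_rfl, 0, G.emptyVertex, Set.finite_empty,
        (add_zero _).symm, zero_mul _⟩
    | cons e w => exact ⟨0, zero_mem _, _, G.singletonVertex (G.source e), Set.finite_singleton _,
        (zero_add _).symm, h.consPair_mul_vertexPair_of_mem (Set.mem_singleton (G.source e)) _⟩
  | zero => exact ⟨0, zero_mem _, 0, G.emptyVertex, Set.finite_empty, (add_zero _).symm, zero_mul _⟩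
  | add a a' _ _ iha iha' =>
    obtain ⟨b, hb, d, F, hF, rfl, hd⟩ := iha
    obtain ⟨b', hb', d', F', hF', rfl, hd'⟩ := iha'
    refine ⟨b + b', add_mem hb hb', d + d', F.union F', hF.union hF', add_add_add_comm _ _ _ _, ?_⟩
    have h1 : vertexPair p F * vertexPair p (F.union F') = vertexPair p F := by
      rw [h.vertexPair_mul_vertexPair]
      exact congrArg _ (Subtype.ext (Set.inter_eq_left.2 Set.subset_union_left))
    have h2 : vertexPair p F' * vertexPair p (F.union F') = vertexPair p F' := by
      rw [h.vertexPair_mul_vertexPair]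
      exact congrArg _ (Subtype.ext (Set.inter_eq_left.2 Set.subset_union_right))
    rw [add_mul, ← hd, ← hd', mul_assoc, mul_assoc, h1, h2]
  | smul c a _ iha =>
    obtain ⟨b, hb, d, F, hF, rfl, hd⟩ := iha
    exact ⟨c • b, Submodule.smul_mem _ _ hb, c • d, F, hF, smul_add _ _ _, by
      rw [smul_mul_assoc, hd]⟩

theorem snd_eq_zero_of_mem_pathSpan (hG : ∀ v, G.IsRegular v) {n : ℕ} {a : ((ℕ → E) → ℂ) × B}
    (ha : a ∈ pathSpan p s n) (ha1 : a.1 = 0) : a.2 = 0 := by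
  induction n generalizing a with
  | zero => exact h.snd_eq_zero_of_mem_pathSpan_zero hG ha ha1
  | succ n ih =>
    -- The compression by `s_e` has length at most `n` and zero function, so the induction
    -- hypothesis kills it.
    have hedge (e : E) : a.2 * (s e * star (s e)) = 0 := by
      have h1 : star (s e) * a.2 * s e = 0 := ih (h.extPair_mem_pathSpan e ha) (by
        funext x
        simp [extPair_fst_apply, ha1])
      have h2 : (s e * star (s e)) * (s e * star (s e)) = s e * star (s e) := by
        rw [← mul_assoc, h.partialIsometry e]
      have h3 : a.2 * (s e * star (s e)) = s e * star (s e) * a.2 := h.commute_of_mem_pathSpan e ha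
      calc a.2 * (s e * star (s e)) = s e * star (s e) * a.2 * (s e * star (s e)) := by
            rw [← h3, mul_assoc, h2]
        _ = s e * (star (s e) * a.2 * s e) * star (s e) := by simp only [mul_assoc]
        _ = 0 := by rw [h1, mul_zero, zero_mul]
    have hvertex (v : V) : a.2 * p (G.singletonVertex v) = 0 := by
      refine (congrArg (a.2 * ·) (h.vertex_eq_sum v (hG v))).trans ?_
      rw [Finset.mul_sum]
      exact Finset.sum_eq_zero fun e _ => hedge e
    obtain ⟨b, hb, d, F, hF, rfl, hd⟩ := h.exists_eq_add_of_mem_pathSpan ha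
    -- On functions `b = -d`, and `d` is supported on `F`; hence `b` vanishes off `F`, and the
    -- length-zero case transfers this to the algebra.
    have hb2 : (b - b * vertexPair p F).2 = 0 := by
      refine h.snd_eq_zero_of_mem_pathSpan_zero hG
        (sub_mem hb (h.mul_vertexPair_mem_pathSpan hb F)) ?_
      have h1 : b.1 = -d.1 := eq_neg_of_add_eq_zero_left ha1
      have h2 : d.1 * (vertexPair p F).1 = d.1 := congrArg Prod.fst hd
      rw [Prod.fst_sub, Prod.fst_mul, h1, neg_mul, h2, sub_self]
    have h1 : b.2 = b.2 * p F := sub_eq_zero.1 hb2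
    have h2 : d.2 * p F = d.2 := congrArg Prod.snd hd
    have h3 : (b + d).2 = (b + d).2 * p F := by
      rw [Prod.snd_add, add_mul, h2, ← h1]
    rw [h3]
    exact (h.mul_p_eq_zero_of_finite hvertex hF).2

end IsCKFamily

end Pairs

/-! ### The homomorphism out of the subshift algebra -/

section PathProjection

variable {B : Type w} [NonUnitalCStarAlgebra B]

/-- The element `q` of the algebra corresponds to the set of paths `A`. -/
def IsPathProjection (p : G.GenVertex → B) (s : E → B) (A : Set (ℕ → E)) (q : B) : Prop :=
  ∃ n, (A.indicator 1, q) ∈ pathSpan p s n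

variable {p : G.GenVertex → B} {s : E → B}

/-- Makes the recursively defined function explicit, so that the sets `C(α, β)` can be recognised
among the pairs. -/
theorem wordPair_fst (A : G.GenVertex) (w : List E) : (wordPair p s A w).1 =
    Set.indicator {y | ∃ x, y = concat w x ∧ y ∈ G.edgeSubshift ∧ G.source (x 0) ∈ A.1} 1 := by
  classical
  induction w with
  | nil =>
    simp only [wordPair, vertexPair, concat_nil, exists_eq_left']
    rfl
  | cons e w ih =>
    funext y
    rw [wordPair, consPair_fst_apply, ih]
    simp only [Set.indicator_apply, Set.mem_ofPred_eq, ← ite_and, Pi.one_apply]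
    refine if_congr ⟨?_, ?_⟩ rfl rfl
    · rintro ⟨⟨hy, rfl⟩, x, hx, -, hxA⟩
      exact ⟨x, by rw [concat_cons, ← hx, concat_head_tail], hy, hxA⟩
    · rintro ⟨x, rfl, hx, hxA⟩
      exact ⟨⟨hx, rfl⟩, x, rfl, (concat_cons_mem_edgeSubshift.1 hx).2, hxA⟩

theorem wordPair_snd (A : G.GenVertex) {w : List E} (hw : w ≠ []) :
    (wordPair p s A w).2 = wordProd s w * p A * star (wordProd s w) := by
  induction w with
  | nil => exact absurd rfl hw
  | cons e w ih =>
    cases w with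
    | nil => rfl
    | cons f w =>
      rw [wordPair, consPair_snd, ih (List.cons_ne_nil f w), wordProd_cons s e (List.cons_ne_nil f w),
        star_mul]
      simp only [mul_assoc]

theorem isPathProjection_pathsFrom (A : G.GenVertex) :
    IsPathProjection p s (G.pathsFrom A.1) (p A) :=
  ⟨0, wordPair_mem_pathSpan (w := []) A le_rfl⟩

theorem isPathProjection_word (A : G.GenVertex) {w : List E} (hw : w ≠ []) :
    IsPathProjection p s {y | ∃ x, y = concat w x ∧ y ∈ G.edgeSubshift ∧ G.source (x 0) ∈ A.1}
      (wordProd s w * p A * star (wordProd s w)) :=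
  ⟨w.length, by
    rw [← wordPair_fst (p := p) (s := s), ← wordPair_snd A hw]
    exact wordPair_mem_pathSpan A le_rfl⟩

theorem isPathProjection_empty : IsPathProjection p s ∅ 0 :=
  ⟨0, by rw [Set.indicator_empty]; exact zero_mem _⟩

namespace IsCKFamily

variable (h : G.IsCKFamily p s)
include h

theorem isPathProjection_follower {α : List E} (hα : α ∈ language G.edgeSubshift) (hα' : α ≠ []) :
    IsPathProjection p s (cyl G.edgeSubshift α []) (star (wordProd s α) * wordProd s α) := by
  obtain ⟨A, h1, -, h3⟩ := h.exists_wordProd_initial α hα hα'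
  convert isPathProjection_pathsFrom A using 1
  ext y
  simp only [cyl, concat_nil, exists_eq_left', h3, pathsFrom, Set.mem_ofPred_eq]
  tauto

/-- Given that `x` is a path, `α x` is a path exactly when `x` starts in the range `A` of `α`; the
middle factor `s_α* s_α` is `p_A`. -/
theorem isPathProjection_cyl {α β : List E} (hα : α ∈ language G.edgeSubshift) (hα' : α ≠ [])
    (hβ' : β ≠ []) : IsPathProjection p s (cyl G.edgeSubshift α β)
      (wordProd s β * star (wordProd s α) * wordProd s α * star (wordProd s β)) := by
  obtain ⟨A, h1, -, h3⟩ := h.exists_wordProd_initial α hα hα'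
  convert isPathProjection_word A hβ' using 1
  · ext y
    constructor
    · rintro ⟨x, rfl, hx, hαx⟩
      exact ⟨x, rfl, hx, ((h3 x).1 hαx).2⟩
    · rintro ⟨x, rfl, hx, hxA⟩
      exact ⟨x, rfl, hx, (h3 x).2 ⟨mem_edgeSubshift_of_concat_mem hx, hxA⟩⟩
  · rw [← h1, mul_assoc (wordProd s β)]

/-- If `β x` is a path then `x` already starts in the range of `β`, so inserting that projection
changes neither the set nor the element. -/
theorem isPathProjection_cylinder {β : List E} (hβ : β ∈ language G.edgeSubshift) (hβ' : β ≠ []) :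
    IsPathProjection p s (cyl G.edgeSubshift [] β) (wordProd s β * star (wordProd s β)) := by
  obtain ⟨A, -, h2, h3⟩ := h.exists_wordProd_initial β hβ hβ'
  convert isPathProjection_word A hβ' using 1
  · ext y
    constructor
    · rintro ⟨x, rfl, hx, -⟩
      exact ⟨x, rfl, hx, ((h3 x).1 hx).2⟩
    · rintro ⟨x, rfl, hx, -⟩
      exact ⟨x, rfl, hx, mem_edgeSubshift_of_concat_mem hx⟩
  · rw [h2]

theorem isPathProjection_inter {A C : Set (ℕ → E)} {a c : B} (hA : IsPathProjection p s A a)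
    (hC : IsPathProjection p s C c) : IsPathProjection p s (A ∩ C) (a * c) := by
  obtain ⟨m, hm⟩ := hA
  obtain ⟨n, hn⟩ := hC
  refine (h.exists_mul_mem_pathSpan hm hn).imp fun k hk => ?_
  rwa [Set.inter_indicator_one]

theorem isPathProjection_diff {A C : Set (ℕ → E)} {a c : B} (hA : IsPathProjection p s A a)
    (hC : IsPathProjection p s C c) : IsPathProjection p s (A \ C) (a - a * c) := by
  classical
  obtain ⟨n, hn⟩ := h.isPathProjection_inter hA hC
  obtain ⟨m, hm⟩ := hA
  refine ⟨max m n, ?_⟩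
  have := sub_mem (pathSpan_mono (le_max_left m n) hm) (pathSpan_mono (le_max_right m n) hn)
  convert this using 1
  refine Prod.ext ?_ rfl
  funext x
  simp only [Prod.mk_sub_mk, Pi.sub_apply, Set.indicator_apply, Set.mem_sdiff, Set.mem_inter_iff]
  split_ifs <;> first | (exfalso; tauto) | simp

theorem isPathProjection_union {A C : Set (ℕ → E)} {a c : B} (hA : IsPathProjection p s A a)
    (hC : IsPathProjection p s C c) : IsPathProjection p s (A ∪ C) (a + c - a * c) := by
  classical
  obtain ⟨n, hn⟩ := h.isPathProjection_diff hA hC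
  obtain ⟨m, hm⟩ := hC
  refine ⟨max m n, ?_⟩
  -- The union is taken as the disjoint union of `A \ C` and `C`.
  have := add_mem (pathSpan_mono (le_max_right m n) hn) (pathSpan_mono (le_max_left m n) hm)
  convert this using 1
  refine Prod.ext ?_ (sub_add_eq_add_sub a (a * c) c).symm
  funext x
  simp only [Prod.mk_add_mk, Pi.add_apply, Set.indicator_apply, Set.mem_sdiff, Set.mem_union]
  split_ifs <;> first | (exfalso; tauto) | simp

theorem isPathProjection_star {A : Set (ℕ → E)} {a : B} (hA : IsPathProjection p s A a) :
    IsPathProjection p s A (star a) := by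
  classical
  obtain ⟨n, hn⟩ := hA
  refine ⟨n, ?_⟩
  convert h.star_mem_pathSpan hn using 1
  refine Prod.ext ?_ rfl
  funext x
  simp only [Prod.fst_star, Pi.star_apply, Set.indicator_apply]
  split_ifs <;> simp

variable (hG : ∀ v, G.IsRegular v)
include hG

/-- The difference of the two pairs has zero function. Every relation between path projections
thereby reduces to an identity of sets. -/
theorem isPathProjection_unique {A : Set (ℕ → E)} {a b : B} (ha : IsPathProjection p s A a)
    (hb : IsPathProjection p s A b) : a = b := by
  obtain ⟨m, hm⟩ := ha
  obtain ⟨n, hn⟩ := hb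
  exact sub_eq_zero.1 (h.snd_eq_zero_of_mem_pathSpan hG
    (sub_mem (pathSpan_mono (le_max_left m n) hm) (pathSpan_mono (le_max_right m n) hn))
    (sub_self (A.indicator 1)))

theorem isStarProjection_of_isPathProjection {A : Set (ℕ → E)} {a : B}
    (ha : IsPathProjection p s A a) : IsStarProjection a where
  isIdempotentElem := h.isPathProjection_unique hG
    (Set.inter_self A ▸ h.isPathProjection_inter ha ha) ha
  isSelfAdjoint := h.isPathProjection_unique hG (h.isPathProjection_star ha) ha

omit hG in
theorem exists_isPathProjection {A : Set (ℕ → E)} (hA : IsBool G.edgeSubshift A) :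
    ∃ a, IsPathProjection p s A a := by
  induction hA with
  | empty => exact ⟨0, isPathProjection_empty⟩
  | @cyl α β hα hβ hαβ =>
    by_cases hα' : α = []
    · subst hα'
      exact ⟨_, h.isPathProjection_cylinder hβ fun hβ' => hαβ ⟨rfl, hβ'⟩⟩
    · by_cases hβ' : β = []
      · subst hβ'
        exact ⟨_, h.isPathProjection_follower hα hα'⟩
      · exact ⟨_, h.isPathProjection_cyl hα hα' hβ'⟩
  | union _ _ ihA ihC =>
    obtain ⟨a, ha⟩ := ihA
    obtain ⟨c, hc⟩ := ihC
    exact ⟨_, h.isPathProjection_union ha hc⟩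
  | inter _ _ ihA ihC =>
    obtain ⟨a, ha⟩ := ihA
    obtain ⟨c, hc⟩ := ihC
    exact ⟨_, h.isPathProjection_inter ha hc⟩
  | diff _ _ ihA ihC =>
    obtain ⟨a, ha⟩ := ihA
    obtain ⟨c, hc⟩ := ihC
    exact ⟨_, h.isPathProjection_diff ha hc⟩

/-- The edges of a Cuntz–Krieger family satisfy the relations of the edge subshift. -/
theorem exists_isSubshiftFamily : ∃ q : BoolAlg G.edgeSubshift → B,
    IsSubshiftFamily G.edgeSubshift q s ∧ ∀ A, IsPathProjection p s A.1 (q A) := by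
  -- The choice is harmless: by `key`, any element built from a description of the set `A` equals `q
  -- A`.
  choose q hq using fun A : BoolAlg G.edgeSubshift => h.exists_isPathProjection A.2
  have key {A : BoolAlg G.edgeSubshift} {a : B} (ha : IsPathProjection p s A.1 a) : q A = a :=
    h.isPathProjection_unique hG (hq A) ha
  have hinter (A C : BoolAlg G.edgeSubshift) :
      q ⟨A.1 ∩ C.1, .inter A.2 C.2⟩ = q A * q C :=
    key (h.isPathProjection_inter (hq A) (hq C))
  exact ⟨q,
    { projection := fun A => h.isStarProjection_of_isPathProjection hG (hq A)
      partialIsometry := h.partialIsometry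
      p_inter := hinter
      p_union := fun A C =>
        (key (h.isPathProjection_union (hq A) (hq C))).trans (congrArg _ (hinter A C).symm)
      p_empty := key isPathProjection_empty
      p_cyl := fun α β hα hβ hα' hβ' => (key (h.isPathProjection_cyl hα hα' hβ')).symm
      p_follower := fun α hα hα' => (key (h.isPathProjection_follower hα hα')).symm
      p_cylinder := fun β hβ hβ' => (key (h.isPathProjection_cylinder hβ hβ')).symm }, hq⟩

end IsCKFamily

end PathProjection

end Ultragraph

/-! ### Projections of a subshift family are determined by its partial isometries -/

namespace Subshift

variable {𝓐 : Type v} {X : Set (ℕ → 𝓐)} {B : Type w} [NonUnitalCStarAlgebra B]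
  {p : BoolAlg X → B} {s : 𝓐 → B}

/-- The relations mention only unions and intersections; differences follow because `A` is the
disjoint union of `A \ C` and `A ∩ C`. -/
theorem IsSubshiftFamily.p_diff (h : IsSubshiftFamily X p s) (A C : BoolAlg X) :
    p ⟨A.1 \ C.1, .diff A.2 C.2⟩ = p A - p A * p C := by
  have congr_p {A C : BoolAlg X} (hAC : A.1 = C.1) : p A = p C := congrArg p (Subtype.ext hAC)
  have h1 := h.p_union ⟨A.1 \ C.1, .diff A.2 C.2⟩ ⟨A.1 ∩ C.1, .inter A.2 C.2⟩
  have h2 := (congr_p (Set.sdiff_union_inter A.1 C.1)).symm.trans h1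
  have h3 := (congrArg _ ((congr_p (C := ⟨∅, .empty⟩)
    (Set.disjoint_sdiff_inter (s := A.1) (t := C.1)).inter_eq).trans h.p_empty)).symm.trans h2.symm
  rw [sub_zero] at h3
  exact eq_sub_of_add_eq ((congrArg _ (h.p_inter A C).symm).trans h3)

/-- An endomorphism which fixes the partial isometries of a subshift family fixes its
projections. -/
theorem IsSubshiftFamily.map_p (h : IsSubshiftFamily X p s) (χ : B →⋆ₙₐ[ℂ] B)
    (hχ : ∀ a, χ (s a) = s a) (A : BoolAlg X) : χ (p A) = p A := by
  have hw (w : List 𝓐) : χ (wordProd s w) = wordProd s w := by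
    rw [map_wordProd]
    simp only [hχ]
  obtain ⟨A, hA⟩ := A
  induction hA with
  | empty =>
    have h0 := h.p_empty
    exact (congrArg χ h0).trans ((map_zero χ).trans h0.symm)
  | @cyl α β hα hβ hαβ =>
    by_cases hα' : α = []
    · subst hα'
      have h1 := h.p_cylinder β hβ fun hβ' => hαβ ⟨rfl, hβ'⟩
      refine (congrArg χ h1.symm).trans (Eq.trans ?_ h1)
      simp only [map_mul, map_star, hw]
    · by_cases hβ' : β = []
      · subst hβ'
        have h1 := h.p_follower α hα hα'
        refine (congrArg χ h1.symm).trans (Eq.trans ?_ h1)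
        simp only [map_mul, map_star, hw]
      · have h1 := h.p_cyl α β hα hβ hα' hβ'
        refine (congrArg χ h1.symm).trans (Eq.trans ?_ h1)
        simp only [map_mul, map_star, hw]
  | @union A C hA hC ihA ihC =>
    have h1 := (h.p_union ⟨A, hA⟩ ⟨C, hC⟩).trans (congrArg _ (h.p_inter ⟨A, hA⟩ ⟨C, hC⟩))
    refine (congrArg χ h1).trans (Eq.trans ?_ h1.symm)
    rw [map_sub, map_add, map_mul]
    exact congrArg₂ _ (congrArg₂ _ ihA ihC) (congrArg₂ _ ihA ihC)
  | @inter A C hA hC ihA ihC =>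
    have h1 := h.p_inter ⟨A, hA⟩ ⟨C, hC⟩
    refine (congrArg χ h1).trans (Eq.trans ?_ h1.symm)
    rw [map_mul]
    exact congrArg₂ _ ihA ihC
  | @diff A C hA hC ihA ihC =>
    have h1 := h.p_diff ⟨A, hA⟩ ⟨C, hC⟩
    refine (congrArg χ h1).trans (Eq.trans ?_ h1.symm)
    rw [map_sub, map_mul]
    exact congrArg₂ _ ihA (congrArg₂ _ ihA ihC)

end Subshift

/-! ### The isomorphism -/

theorem mainTheorem11 {V : Type u} {E : Type v} (G : Ultragraph V E)
    (hG : ∀ x : V, G.IsRegular x) :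
    Nonempty (G.CStar ≃⋆ₐ[ℂ] Subshift.CStar G.edgeSubshift) := by
  have hCK := Ultragraph.CStar.isCKFamily G
  have hS := Subshift.CStar.isSubshiftFamily G.edgeSubshift
  obtain ⟨q, hq, hqA⟩ := hCK.exists_isSubshiftFamily hG
  obtain ⟨φ, ⟨hφp, hφs⟩, -⟩ := Ultragraph.CStar.existsUnique_lift G
    (Ultragraph.isCKFamily_of_isSubshiftFamily hG hS)
  obtain ⟨ψ, ⟨hψp, hψs⟩, -⟩ := Subshift.CStar.existsUnique_lift hq
  have hψφ : ψ.comp φ = NonUnitalStarAlgHom.id ℂ G.CStar := by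
    refine UniversalCStar.hom_ext ?_
    rintro (A | e)
    · refine (congrArg ψ (hφp A)).trans ((hψp _).trans ?_)
      -- Both `q` of the paths from `A` and the generator `p_A` are path projections of the same
      -- set.
      exact hCK.isPathProjection_unique hG (hqA _) (Ultragraph.isPathProjection_pathsFrom A)
    · exact (congrArg ψ (hφs e)).trans (hψs e)
  have hφψ : φ.comp ψ = NonUnitalStarAlgHom.id ℂ (Subshift.CStar G.edgeSubshift) := by
    have hs (e : E) : φ.comp ψ (UniversalCStar.gen _ _ (Sum.inr e)) =
        UniversalCStar.gen _ _ (Sum.inr e) := (congrArg φ (hψs e)).trans (hφs e)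
    refine UniversalCStar.hom_ext ?_
    rintro (A | e)
    -- No formula for `φ` on the chosen projections is needed: fixing the edge generators forces the
    -- projections to be fixed.
    · exact hS.map_p (φ.comp ψ) hs A
    · exact hs e
  exact ⟨{ φ with
    invFun := ψ
    left_inv := fun a => DFunLike.congr_fun hψφ a
    right_inv := fun a => DFunLike.congr_fun hφψ a }⟩
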